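/- Let $d\ge 2$. For a field $K$ of characteristic zero and $(c,a)=(c_1,\dots,c_{d-2},a)\in K^{d-1}$ put $$P_{c,a}(z)=\frac1d z^d+\sum_{j=2}^{d-1}(-1)^{d-j}\sigma_{d-j}(c)\frac{z^j}{j}+a^d ,$$ where $\sigma_j(c)$ is the elementary symmetric polynomial of degree $j$ in $c_1,\dots,c_{d-2}$; with $c_0:=0$, its critical points are $c_0,\dots,c_{d-2}$. For every place $v$ of $\mathbb Q$ let $\mathbb C_v$ be $\mathbb C$ (if $v=\infty$) or $\mathbb C_p$ (if $v=p$, with $|p|_p=p^{-1}$), and fix an arbitrary embedding $\overline{\mathbb Q}\hookrightarrow\mathbb C_v$. For $(c,a)\in\mathbb C_v^{d-1}$ and $z\in\mathbb C_v$ let $$g_{c,a,v}(z)=\lim_{n\to\infty}d^{-n}\log^+|P_{c,a}^n(z)|_v,\qquad G_v(c,a)=\max_{0\le i\le d-2}g_{c,a,v}(c_i).$$ Let $|\cdot|_{G_v}$ be the metric on $\mathcal O(1)\to\mathbb P^{d-1}(\mathbb C_v)$ equal to $|\sigma|_v e^{-G_v}$ on the affine chart $\{[1:c:a]\}$ (a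 section $\sigma$, i.e. a linear form, being identified with the function $\sigma(1,c,a)$) and extended by continuity to the hyperplane at infinity. For $x$ in $\mathbb P^{d-1}(\overline{\mathbb Q})$ or in $\overline{\mathbb Q}^{n}$ let $O(x)$ be its orbit under $\mathrm{Gal}(\overline{\mathbb Q}/\mathbb Q)$ and $\deg(x)$ the cardinality of $O(x)$. The bifurcation height $h_{\rm bif}:\mathbb P^{d-1}(\overline{\mathbb Q})\to\mathbb R$ is the height induced by these metrics, $$h_{\rm bif}(x)=\frac1{\deg(x)}\sum_{v}\sum_{y\in O(x)}-\log|\sigma(y)|_{G_v},$$ where the sum is over all places $v$ of $\mathbb Q$ and $\sigma$ is any section of $\mathcal O(1)$ over $\mathbb P^{d-1}_{\mathbb Q}$ (linear form with rational coefficients) that does not vanish on $O(x)$; write $h_{\rm bif}(c,a)=h_{\rm bif}([1:c:a])$. The naive height is $h_{\rm nv}(x)=\frac1{\deg (x)}\sum_v\sum_{y\in O(x)}\log^+\max_i|y_i|_v$ for $x\in\overline{\mathbb Q}^{n}$; put $h_{P_{c,a}}(w)=\lim_{n\to\infty}d^{-n}h_{\rm nv}(P_{c,a}^n(w))$ for $w\in\overline{\mathbb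 Q}$, and $h_{\rm Ingram}(c,a)=\sum_{i=0}^{d-2}h_{P_{c,a}}(c_i)$. **Theorem.** For every $(c,a)\in\overline{\mathbb Q}^{d-1}$, the value $h_{\rm bif}(c,a)$ does not depend on the section $\sigma$ used to compute it, and $$h_{\rm bif}(c,a)=\frac1{\deg(c,a)}\sum_{v}\sum_{z\in O(c,a)}G_v(z),$$ where $O(c,a)$ is finite and all but finitely many terms of each of these sums over $v$ vanish. Moreover $h_{\rm bif}(c,a)\ge0$ for all $(c,a)\in\overline{\mathbb Q}^{d-1}$; $\sup_{\overline{\mathbb Q}^{d-1}}|h_{\rm bif}-h_{\rm nv}|<\infty$; $h_{\rm bif}\le h_{\rm Ingram}\le(d-1)\,h_{\rm bif}$ on $\overline{\mathbb Q}^{d-1}$; and $h_{\rm bif}(c,a)=0$ if and only if $P_{c,a}$ is postcritically finite, i.e. the forward orbit of every critical point of $P_{c,a}$ is finite. -/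

import Mathlib

open Filter Topology Polynomial
open scoped LinearAlgebra.Projectivization

noncomputable section

namespace BifHeight

/-! Throughout, `m : ℕ` and the degree is `d = m + 2`, so that `d` runs over all integers `≥ 2`.
A parameter `(c, a) = (c₁, …, c_{d-2}, a)` is a vector `z : Fin (m + 1) → K`, whose first
`m = d - 2` coordinates are the `cᵢ` and whose last coordinate is `a`. -/

section Family

variable {K : Type*} [Field K] {m : ℕ}

/-- The coordinates `c₁, …, c_{d-2}` of a parameter. -/
def cPart (z : Fin (m + 1) → K) : Fin m → K := fun i => z i.castSucc

/-- The coordinate `a` of a parameter. -/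
def aPart (z : Fin (m + 1) → K) : K := z (Fin.last m)

/-- The marked critical points `c₀ = 0, c₁, …, c_{d-2}`. -/
def crit (z : Fin (m + 1) → K) : Fin (m + 1) → K := Fin.cons 0 (cPart z)

/-- The polynomial
`P_{c,a}(X) = X^d / d + ∑_{j=2}^{d-1} (-1)^{d-j} σ_{d-j}(c) X^j / j + a^d`, where `d = m + 2`. -/
def critPoly (z : Fin (m + 1) → K) : K[X] :=
  C (1 / ((m + 2 : ℕ) : K)) * X ^ (m + 2)
    + ∑ j ∈ Finset.Icc 2 (m + 1),
        C ((-1) ^ (m + 2 - j) * (Finset.univ.val.map (cPart z)).esymm (m + 2 - j) / (j : K)) * X ^ j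
    + C (aPart z ^ (m + 2))

/-- The map `w ↦ P_{c,a}(w)`. -/
def evalP (z : Fin (m + 1) → K) (w : K) : K := (critPoly z).eval w

/-- `P` is postcritically finite: the set of all `Pⁿ(w)`, with `n ≥ 1` and `w` a critical point of
`P`, is finite. (Here `K` is algebraically closed in the applications.) -/
def IsPostcriticallyFinite (P : K[X]) : Prop :=
  {y : K | ∃ w : K, P.derivative.IsRoot w ∧ ∃ n : ℕ, 1 ≤ n ∧ y = (fun t => P.eval t)^[n] w}.Finite

end Family

section Local

variable {K : Type*} [NormedField K] {m : ℕ}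

/-- The Green function `g_{c,a}(w) = lim d⁻ⁿ log⁺ |P_{c,a}ⁿ(w)|` over a normed field. -/
def green (z : Fin (m + 1) → K) (w : K) : ℝ :=
  limUnder atTop fun n : ℕ => Real.posLog ‖(evalP z)^[n] w‖ / ((m + 2 : ℕ) : ℝ) ^ n

/-- `G(c,a) = max_{0 ≤ i ≤ d-2} g_{c,a}(cᵢ)`. -/
def bigG (z : Fin (m + 1) → K) : ℝ := ⨆ i : Fin (m + 1), green z (crit z i)

/-- `|σ|_G = |σ| e^{-G}` at the point `[W₀ : ⋯ : W_{d-1}]` with `W₀ ≠ 0`, where the section `σ` of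
`𝒪(1)` is the linear form with coefficients `s`, identified with the function
`(∑ sᵢ Wᵢ) / W₀` on the affine chart, whose coordinates are `(c, a) = (W₁, …, W_{d-1}) / W₀`. -/
def affineSectionNorm (s : Fin (m + 2) → ℚ) (W : Fin (m + 2) → K) : ℝ :=
  ‖(∑ i, (s i : K) * W i) / W 0‖ * Real.exp (-bigG fun i : Fin (m + 1) => W i.succ / W 0)

open Classical in
/-- The metric `|·|_G` on `𝒪(1)` over `ℙ^{d-1}(K)`: it is `|σ| e^{-G}` on the affine chart, and is
extended by continuity to the hyperplane at infinity `W₀ = 0`. -/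
def sectionNorm (s : Fin (m + 2) → ℚ) (y : ℙ K (Fin (m + 2) → K)) : ℝ :=
  if y.rep 0 ≠ 0 then affineSectionNorm s y.rep
  else limUnder (𝓝[{W : Fin (m + 2) → K | W 0 ≠ 0}] y.rep) (affineSectionNorm s)

end Local

section Places

/-- The places of `ℚ`: `none` is the archimedean place, `some p` is the `p`-adic place. -/
abbrev Place : Type := Option Nat.Primes

instance factPrime (p : Nat.Primes) : Fact (p : ℕ).Prime := ⟨p.2⟩

/-- `ℂ_v`: the field `ℂ` for the archimedean place and `ℂ_p` for the `p`-adic place. -/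
def Cv : Place → Type
  | none => ℂ
  | some p => ℂ_[(p : ℕ)]

instance instNormedFieldCv : (v : Place) → NormedField (Cv v)
  | none => inferInstanceAs (NormedField ℂ)
  | some p => inferInstanceAs (NormedField ℂ_[(p : ℕ)])

/-- The field `ℚ̄`. -/
abbrev Qbar : Type := AlgebraicClosure ℚ

end Places

section Galois

/-- A ring homomorphism applied to all coordinates of a vector. -/
def coordMap {K L : Type*} [Field K] [Field L] (f : K →+* L) (n : ℕ) :
    (Fin n → K) →ₛₗ[f] (Fin n → L) where
  toFun x i := f (x i)
  map_add' x y := by ext i; simp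
  map_smul' r x := by ext i; simp

theorem coordMap_injective {K L : Type*} [Field K] [Field L] (f : K →+* L) (n : ℕ) :
    Function.Injective (coordMap f n) := fun _ _ h =>
  funext fun i => f.injective (congrFun h i)

/-- The map `ℙ^{n-1}(K) → ℙ^{n-1}(L)` induced by a ring homomorphism `K → L`. -/
def projMap {K L : Type*} [Field K] [Field L] (f : K →+* L) {n : ℕ} :
    ℙ K (Fin n → K) → ℙ L (Fin n → L) :=
  Projectivization.map (coordMap f n) (coordMap_injective f n)

/-- The orbit under `Gal(ℚ̄/ℚ)` of a vector with coordinates in `ℚ̄`. -/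
def orbit {n : ℕ} (x : Fin n → Qbar) : Set (Fin n → Qbar) :=
  Set.range fun τ : Qbar ≃ₐ[ℚ] Qbar => fun i => τ (x i)

/-- The orbit under `Gal(ℚ̄/ℚ)` of a point of projective space over `ℚ̄`. -/
def projOrbit {n : ℕ} (x : ℙ Qbar (Fin n → Qbar)) : Set (ℙ Qbar (Fin n → Qbar)) :=
  Set.range fun τ : Qbar ≃ₐ[ℚ] Qbar => projMap (τ : Qbar →+* Qbar) x

/-- The point `[1 : c : a]`. -/
def affinePoint {m : ℕ} (z : Fin (m + 1) → Qbar) : ℙ Qbar (Fin (m + 2) → Qbar) :=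
  Projectivization.mk Qbar (Fin.cons 1 z : Fin (m + 2) → Qbar)
    (fun h => one_ne_zero (congrFun h 0))

end Galois

section Heights

/-- For every place `v` an embedding `ℚ̄ → ℂ_v` is fixed, to evaluate `|·|_v` on `ℚ̄`. -/
abbrev Embeddings : Type := (v : Place) → Qbar →+* Cv v

variable (ι : Embeddings) {m : ℕ}

/-- The naive height
`h_nv(x) = (1 / deg x) ∑_v ∑_{y ∈ O(x)} log⁺ max |yᵢ|_v` of `x ∈ ℚ̄ⁿ`
(the norm on `Fin n → Cv v` is the maximum norm). -/
def naiveHeight {n : ℕ} (x : Fin n → Qbar) : ℝ :=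
  (1 / ((orbit x).ncard : ℝ)) *
    ∑ᶠ v : Place, ∑ᶠ y ∈ orbit x, Real.posLog ‖fun i => ι v (y i)‖

/-- The canonical height `h_{P_{c,a}}(w) = lim d⁻ⁿ h_nv(P_{c,a}ⁿ(w))` of `w ∈ ℚ̄`. -/
def canonicalHeight (z : Fin (m + 1) → Qbar) (w : Qbar) : ℝ :=
  limUnder atTop fun n : ℕ =>
    naiveHeight ι (fun _ : Fin 1 => (evalP z)^[n] w) / ((m + 2 : ℕ) : ℝ) ^ n

/-- Ingram's height `∑_{i=0}^{d-2} h_{P_{c,a}}(cᵢ)`. -/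
def ingramHeight (z : Fin (m + 1) → Qbar) : ℝ :=
  ∑ i : Fin (m + 1), canonicalHeight ι z (crit z i)

/-- `G_v(c,a)` for a parameter `(c,a)` with coordinates in `ℚ̄`. -/
def localG (v : Place) (z : Fin (m + 1) → Qbar) : ℝ := bigG fun i => ι v (z i)

/-- `∑_{y ∈ O(x)} -log |σ(y)|_v`, where `|·|_v` is the metric `|·|_{G_v}` on `𝒪(1)` and `σ` is the
linear form with coefficients `s`. -/
def sectionTerm (s : Fin (m + 2) → ℚ) (x : ℙ Qbar (Fin (m + 2) → Qbar)) (v : Place) : ℝ :=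
  ∑ᶠ y ∈ projOrbit x, -Real.log (sectionNorm s (projMap (ι v) y))

/-- The section of `𝒪(1)` over `ℙ^{d-1}_ℚ` given by the linear form with coefficients `s` has no
zero on the orbit of `x`. -/
def NonvanishingOn (s : Fin (m + 2) → ℚ) (x : ℙ Qbar (Fin (m + 2) → Qbar)) : Prop :=
  ∀ y ∈ projOrbit x, ∑ i, (s i : Qbar) * y.rep i ≠ 0

/-- The bifurcation height on `ℙ^{d-1}(ℚ̄)`: the height
`(1 / deg x) ∑_v ∑_{y ∈ O(x)} -log |σ(y)|_v` induced by the metrics `|·|_{G_v}` on `𝒪(1)`, where `σ`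
is any section of `𝒪(1)` over `ℙ^{d-1}_ℚ` that does not vanish on `O(x)`. -/
def bifHeight (x : ℙ Qbar (Fin (m + 2) → Qbar)) : ℝ :=
  (1 / ((projOrbit x).ncard : ℝ)) *
    ∑ᶠ v : Place, sectionTerm ι (Classical.epsilon fun s => NonvanishingOn s x) x v

/-- `h_bif(c,a)`, the bifurcation height at the point `[1 : c : a]`. -/
def hbif (z : Fin (m + 1) → Qbar) : ℝ := bifHeight ι (affinePoint z)

end Heights

end BifHeight

end

open BifHeight

/-! Everything rests on one local estimate: |G_v(c,a) - log⁺‖(c,a)‖_v| ≤ 3 log A_v, where A_v = 1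
for all but finitely many v (`EscapeBound.abs_bigG_sub_le`, `exists_escapeBound`). Since P_{c,a}(w)
is homogeneous of degree d = m + 2 in (c, a, w) jointly, scaling by the largest coordinate reduces
the required bounds to bounds on a unit polydisc. The upper estimate for G_v is polynomial growth.
For the lower one, the critical values are forms of degree d in (c, a) whose only common zero is the
origin, so by the Nullstellensatz a power of each coordinate lies in the ideal they generate. Some
critical value therefore has size at least ‖(c,a)‖^d / A_v, and it escapes when ‖(c,a)‖ is large.
Only polynomial identities with rational coefficients are used, so the constants are 1 at almost all
primes.

The global statements follow. The product of σ over a Galois orbit is a nonzero rational number, so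
by the product formula h_bif is the average of the G_v over the orbit (`sum_sectionTerm`). Summing
the local estimate gives the comparison with the naive height. Ingram's height is the average of the
sums of local Green functions at the critical points, and the sum of d - 1 nonnegative numbers lies
between their maximum and d - 1 times it.

If h_bif = 0, all local Green functions vanish at the critical points of all conjugates. The
critical orbits, which lie in one number field, are then bounded at every place, and by 1 at almost
all, so Northcott's theorem makes them finite (`finite_of_norm_le`). Conversely, the Green function
vanishes on finite orbits. -/

namespace BifHeight

/-! ### Algebra of the family: homogeneity, base change, critical points. -/

section Generic

/-- The expression defining `P_{c,a}(w)`, over any commutative `ℚ`-algebra. -/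
def genericEval {R : Type*} [CommRing R] [Algebra ℚ R] {m : ℕ} (z : Fin (m + 1) → R) (w : R) : R :=
  algebraMap ℚ R (1 / ((m + 2 : ℕ) : ℚ)) * w ^ (m + 2)
    + ∑ j ∈ Finset.Icc 2 (m + 1), algebraMap ℚ R ((-1) ^ (m + 2 - j) / (j : ℚ)) *
        (∑ t ∈ Finset.univ.powersetCard (m + 2 - j), ∏ i ∈ t, z (Fin.castSucc i)) * w ^ j
    + z (Fin.last m) ^ (m + 2)

theorem map_genericEval {R S : Type*} [CommRing R] [Algebra ℚ R] [CommRing S] [Algebra ℚ S]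
    (f : R →+* S) {m : ℕ} (z : Fin (m + 1) → R) (w : R) :
    f (genericEval z w) = genericEval (fun i => f (z i)) (f w) := by
  have h (q : ℚ) : f (algebraMap ℚ R q) = algebraMap ℚ S q := by
    rw [← RingHom.comp_apply, RingHom.ext_rat (f.comp (algebraMap ℚ R)) (algebraMap ℚ S)]
  simp only [genericEval, map_add, map_mul, map_sum, map_pow, map_prod, h]

theorem genericEval_smul {R : Type*} [CommRing R] [Algebra ℚ R] {m : ℕ} (t : R)
    (z : Fin (m + 1) → R) (w : R) :
    genericEval (fun i => t * z i) (t * w) = t ^ (m + 2) * genericEval z w := by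
  simp only [genericEval, mul_add, Finset.mul_sum, Finset.prod_mul_distrib, Finset.prod_const,
    mul_pow]
  congr 2
  · ring
  refine Finset.sum_congr rfl fun j hj => ?_
  rw [Finset.sum_mul, Finset.sum_mul, Finset.mul_sum]
  refine Finset.sum_congr rfl fun s hs => ?_
  rw [(Finset.mem_powersetCard.1 hs).2]
  have : t ^ (m + 2) = t ^ (m + 2 - j) * t ^ j := by
    rw [← pow_add]; congr 1; have := (Finset.mem_Icc.1 hj).2; omega
  rw [this]; ring

variable {K : Type*} [Field K] {m : ℕ}

theorem evalP_eq_genericEval [CharZero K] (z : Fin (m + 1) → K) (w : K) :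
    evalP z w = genericEval z w := by
  simp only [evalP, critPoly, genericEval, eval_add, eval_mul, eval_C, eval_pow, eval_X,
    eval_finsetSum, aPart, Finset.esymm_map_val]
  congr 2
  · simp
  refine Finset.sum_congr rfl fun j _ => ?_
  have (t : Finset (Fin m)) : t.prod (cPart z) = ∏ i ∈ t, z i.castSucc := rfl
  simp only [this, map_div₀, map_pow, map_neg, map_one, map_natCast]
  ring

theorem evalP_smul [CharZero K] (t : K) (z : Fin (m + 1) → K) (w : K) :
    evalP (fun i => t * z i) (t * w) = t ^ (m + 2) * evalP z w := by
  simp only [evalP_eq_genericEval, genericEval_smul]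

theorem map_evalP {L : Type*} [Field L] (f : K →+* L) [CharZero K]
    (z : Fin (m + 1) → K) (w : K) : f (evalP z w) = evalP (fun i => f (z i)) (f w) := by
  have : CharZero L := (RingHom.charZero_iff f.injective).1 inferInstance
  simp only [evalP_eq_genericEval, map_genericEval]

theorem map_evalP_iterate {L : Type*} [Field L] (f : K →+* L) [CharZero K]
    (z : Fin (m + 1) → K) (w : K) (n : ℕ) :
    f ((evalP z)^[n] w) = (evalP fun i => f (z i))^[n] (f w) :=
  Function.Semiconj.iterate_right (f := f) (fun w => map_evalP f z w) n w

theorem map_crit {L : Type*} [Field L] (f : K →+* L) (z : Fin (m + 1) → K) (i : Fin (m + 1)) :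
    f (crit z i) = crit (fun i => f (z i)) i := by
  refine Fin.cases ?_ (fun i => ?_) i <;> simp [crit, cPart]

theorem derivative_critPoly [CharZero K] (z : Fin (m + 1) → K) :
    (critPoly z).derivative = ∏ i, (X - C (crit z i)) := by
  have h1 : ∏ i : Fin m, (X - C (cPart z i)) = ∑ j ∈ Finset.range (m + 1),
      (-1 : K[X]) ^ j * (C ((Finset.univ.val.map (cPart z)).esymm j) * X ^ (m - j)) := by
    have := Multiset.prod_X_sub_X_eq_sum_esymm (Finset.univ.val.map (cPart z))
    rw [Multiset.map_map, Multiset.card_map, Finset.card_val, Finset.card_fin] at this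
    exact this
  rw [Fin.prod_univ_succ]
  simp only [crit, Fin.cons_zero, Fin.cons_succ, map_zero, sub_zero, h1]
  rw [Finset.sum_range_succ', critPoly]
  simp only [derivative_add, derivative_sum, derivative_C_mul, derivative_X_pow, derivative_C]
  rw [mul_add, add_zero, add_comm]
  congr 1
  · rw [Finset.mul_sum]
    refine Finset.sum_bij' (fun j _ => m + 1 - j) (fun i _ => m + 1 - i) ?_ ?_ ?_ ?_ ?_
    · intro j hj; simp only [Finset.mem_Icc, Finset.mem_range] at *; omega
    · intro j hj; simp only [Finset.mem_Icc, Finset.mem_range] at *; omega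
    · intro j hj; simp only [Finset.mem_Icc] at *; omega
    · intro j hj; simp only [Finset.mem_range] at *; omega
    intro j hj
    obtain ⟨h2, hj⟩ := Finset.mem_Icc.1 hj
    have hj0 : (j : K) ≠ 0 := by exact_mod_cast (by omega : j ≠ 0)
    rw [show m + 1 - j + 1 = m + 2 - j by omega, ← mul_assoc (C _), ← C_mul, div_mul_cancel₀ _ hj0,
      show j - 1 = m - (m + 2 - j) + 1 by omega, pow_succ]
    simp only [C_mul, C_pow, C_neg, C_1]
    ring
  · have h2 : ((m + 2 : ℕ) : K) ≠ 0 := by exact_mod_cast (by omega : m + 2 ≠ 0)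
    rw [← mul_assoc, ← C_mul, one_div_mul_cancel h2]
    simp [Multiset.esymm, pow_succ', Multiset.powersetCard_zero_left]

theorem isRoot_derivative_critPoly [CharZero K] (z : Fin (m + 1) → K) (w : K) :
    (critPoly z).derivative.IsRoot w ↔ ∃ i, w = crit z i := by
  rw [derivative_critPoly, IsRoot, eval_prod, Finset.prod_eq_zero_iff]
  simp [sub_eq_zero]

theorem natDegree_critPoly_le (z : Fin (m + 1) → K) : (critPoly z).natDegree ≤ m + 2 := by
  refine natDegree_add_le_of_degree_le (natDegree_add_le_of_degree_le
    (natDegree_C_mul_X_pow_le _ _) (natDegree_sum_le_of_forall_le _ _ fun j hj => ?_)) (by simp)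
  exact (natDegree_C_mul_X_pow_le _ _).trans (by have := (Finset.mem_Icc.1 hj).2; omega)

/-- A parameter all of whose critical values vanish is trivial. -/
theorem eq_zero_of_evalP_crit_eq_zero [CharZero K] (z : Fin (m + 1) → K)
    (h : ∀ i, evalP z (crit z i) = 0) : z = 0 := by
  classical
  have hP : (critPoly z).derivative ≠ 0 := by
    rw [derivative_critPoly]
    exact Finset.prod_ne_zero_iff.2 fun i _ => X_sub_C_ne_zero _
  have hP0 : critPoly z ≠ 0 := fun h => hP (by rw [h, derivative_zero])
  have hr : (critPoly z).derivative.roots = Finset.univ.val.map (crit z) := by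
    rw [derivative_critPoly, ← roots_multiset_prod_X_sub_C (Finset.univ.val.map (crit z)),
      Multiset.map_map]
    rfl
  -- A root of `P` loses exactly one from its multiplicity in `P'`. If all critical points are roots
  -- of `P`, then (d - 1) + #{distinct critical points} ≤ d, so all of them equal c₀ = 0. What
  -- remains is X^d / d + a^d, whose vanishing at 0 gives a = 0.
  have hle : (critPoly z).derivative.roots + (Finset.univ.image (crit z)).val
      ≤ (critPoly z).roots := by
    refine Multiset.le_iff_count.2 fun s => ?_
    rw [Multiset.count_add]
    by_cases hs : s ∈ Finset.univ.image (crit z)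
    · obtain ⟨i, -, rfl⟩ := Finset.mem_image.1 hs
      have hroot : (critPoly z).IsRoot (crit z i) := h i
      rw [Multiset.count_eq_one_of_mem (Finset.nodup _) hs, count_roots, count_roots,
        derivative_rootMultiplicity_of_root hroot]
      have := (rootMultiplicity_pos hP0).2 hroot
      omega
    · have hs' : s ∉ (critPoly z).derivative.roots := by
        rw [hr]
        intro hc
        obtain ⟨i, -, rfl⟩ := Multiset.mem_map.1 hc
        exact hs (Finset.mem_image_of_mem _ (Finset.mem_univ i))
      rw [Multiset.count_eq_zero_of_notMem hs',
        Multiset.count_eq_zero_of_notMem (by rwa [Finset.mem_val])]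
      exact Nat.zero_le _
  have hcard := (Multiset.card_le_card hle).trans
    ((card_roots' _).trans (natDegree_critPoly_le z))
  rw [Multiset.card_add, hr, Multiset.card_map, Finset.card_val, Finset.card_val,
    Finset.card_fin] at hcard
  have hcrit (i) : crit z i = 0 :=
    Finset.card_le_one.1 (by omega : (Finset.univ.image (crit z)).card ≤ 1) _ (by simp)
      (crit z 0) (by simp)
  funext i
  refine Fin.lastCases ?_ (fun i => ?_) i
  · have h0 := h 0
    rw [evalP_eq_genericEval, hcrit, genericEval, Finset.sum_eq_zero fun j hj => ?_] at h0
    · simpa using h0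
    · rw [zero_pow (by have := (Finset.mem_Icc.1 hj).1; omega), mul_zero]
  · exact hcrit i.succ

end Generic

/-! ### Escape estimates and Green functions over a normed field. -/

section Escape

variable {K : Type*} [NormedField K] {m : ℕ} {A : ℝ}

/-- Estimates for the family `P_{c,a}` over a normed field, with all constants bounded by `A`. -/
structure EscapeBound (K : Type*) [NormedField K] (m : ℕ) (A : ℝ) : Prop where
  one_le : 1 ≤ A
  upper : ∀ (z : Fin (m + 1) → K) (w : K), ‖evalP z w‖ ≤ A * max ‖w‖ ‖z‖ ^ (m + 2)
  lower : ∀ (z : Fin (m + 1) → K) (w : K), A * ‖z‖ < ‖w‖ → ‖w‖ ^ (m + 2) ≤ A * ‖evalP z w‖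
  crit : ∀ z : Fin (m + 1) → K, ∃ i, ‖z‖ ^ (m + 2) ≤ A * ‖evalP z (crit z i)‖

/-- `log max(|w|, |c|, |a|, 1)`. -/
noncomputable def logMax (z : Fin (m + 1) → K) (w : K) : ℝ := Real.log (max ‖w‖ (max 1 ‖z‖))

theorem logMax_nonneg (z : Fin (m + 1) → K) (w : K) : 0 ≤ logMax z w :=
  Real.log_nonneg (by simp)

theorem posLog_le_logMax (z : Fin (m + 1) → K) (w : K) : Real.posLog ‖w‖ ≤ logMax z w := by
  rw [Real.posLog_eq_log_max_one (norm_nonneg _)]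
  exact Real.log_le_log (by positivity)
    (max_le (le_max_of_le_right (le_max_left _ _)) (le_max_left _ _))

theorem logMax_le_posLog_add (z : Fin (m + 1) → K) (w : K) :
    logMax z w ≤ Real.posLog ‖w‖ + Real.posLog ‖z‖ := by
  rw [Real.posLog_eq_log_max_one (norm_nonneg _), Real.posLog_eq_log_max_one (norm_nonneg _),
    ← Real.log_mul (by positivity) (by positivity)]
  refine Real.log_le_log (by positivity) (max_le ?_ ?_)
  · exact (le_max_right 1 _).trans (le_mul_of_one_le_right (by positivity) (le_max_left _ _))
  · exact le_mul_of_one_le_left (by positivity) (le_max_left _ _)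

namespace EscapeBound

variable (h : EscapeBound K m A)
include h

theorem log_nonneg : 0 ≤ Real.log A := Real.log_nonneg h.one_le

theorem logMax_evalP_le (z : Fin (m + 1) → K) (w : K) :
    logMax z (evalP z w) ≤ (m + 2 : ℕ) * logMax z w + Real.log A := by
  have hA := h.one_le
  rw [logMax, logMax, ← Real.log_pow, add_comm (Real.log _), ← Real.log_mul (by positivity) (by positivity)]
  refine Real.log_le_log (by positivity) (max_le ((h.upper z w).trans ?_) ?_)
  · gcongr
    exact le_max_right _ _
  · have h1 : 1 ≤ max ‖w‖ (max 1 ‖z‖) := by simp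
    calc max 1 ‖z‖ ≤ max ‖w‖ (max 1 ‖z‖) := le_max_right _ _
      _ ≤ max ‖w‖ (max 1 ‖z‖) ^ (m + 2) := le_self_pow₀ h1 (by omega)
      _ ≤ _ := le_mul_of_one_le_left (by positivity) hA

/-- One iteration costs an error log A; adding log A before dividing absorbs it, because 2 log A ≤ d
log A. Monotonicity gives the existence of the limit, and comparison with n = 0 gives `green_le`. -/
theorem antitone_logMax (z : Fin (m + 1) → K) (w : K) :
    Antitone fun n : ℕ => (logMax z ((evalP z)^[n] w) + Real.log A) / ((m + 2 : ℕ) : ℝ) ^ n := by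
  refine antitone_nat_of_succ_le fun n => ?_
  rw [Function.iterate_succ_apply', div_le_div_iff₀ (by positivity) (by positivity), pow_succ]
  have h1 := h.logMax_evalP_le z ((evalP z)^[n] w)
  have h2 := h.log_nonneg
  have h3 : (2 : ℝ) ≤ ((m + 2 : ℕ) : ℝ) := by push_cast; linarith [(Nat.cast_nonneg m : (0:ℝ) ≤ m)]
  have h4 : (0 : ℝ) < ((m + 2 : ℕ) : ℝ) ^ n := by positivity
  calc _ ≤ (((m + 2 : ℕ) * logMax z ((evalP z)^[n] w) + Real.log A) + Real.log A)
        * ((m + 2 : ℕ) : ℝ) ^ n := by gcongr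
    _ ≤ ((m + 2 : ℕ) * (logMax z ((evalP z)^[n] w) + Real.log A)) * ((m + 2 : ℕ) : ℝ) ^ n := by
        gcongr
        nlinarith
    _ = _ := by ring

omit h in
theorem tendsto_const_div_degree_pow (m : ℕ) (c : ℝ) :
    Tendsto (fun n : ℕ => c / ((m + 2 : ℕ) : ℝ) ^ n) atTop (𝓝 0) := by
  refine Tendsto.div_atTop tendsto_const_nhds (tendsto_pow_atTop_atTop_of_one_lt ?_)
  push_cast; linarith [(Nat.cast_nonneg m : (0:ℝ) ≤ m)]

theorem exists_tendsto (z : Fin (m + 1) → K) (w : K) : ∃ l : ℝ,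
    Tendsto (fun n : ℕ => (logMax z ((evalP z)^[n] w) + Real.log A) / ((m + 2 : ℕ) : ℝ) ^ n)
      atTop (𝓝 l) ∧
    Tendsto (fun n : ℕ => Real.posLog ‖(evalP z)^[n] w‖ / ((m + 2 : ℕ) : ℝ) ^ n)
      atTop (𝓝 l) := by
  have h0 : BddBelow (Set.range fun n : ℕ =>
      (logMax z ((evalP z)^[n] w) + Real.log A) / ((m + 2 : ℕ) : ℝ) ^ n) := by
    refine ⟨0, ?_⟩
    rintro _ ⟨n, rfl⟩
    have := logMax_nonneg z ((evalP z)^[n] w)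
    have := h.log_nonneg
    positivity
  have h1 := tendsto_atTop_ciInf (h.antitone_logMax z w) h0
  refine ⟨_, h1, ?_⟩
  have h2 := h1.sub (tendsto_const_div_degree_pow m (Real.posLog ‖z‖ + Real.log A))
  rw [sub_zero] at h2
  refine tendsto_of_tendsto_of_tendsto_of_le_of_le h2 h1 (fun n => ?_) fun n => ?_
  · simp only [← sub_div]
    gcongr
    linarith [logMax_le_posLog_add z ((evalP z)^[n] w)]
  · dsimp only
    gcongr
    linarith [posLog_le_logMax z ((evalP z)^[n] w), h.log_nonneg]

theorem tendsto_green (z : Fin (m + 1) → K) (w : K) :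
    Tendsto (fun n : ℕ => Real.posLog ‖(evalP z)^[n] w‖ / ((m + 2 : ℕ) : ℝ) ^ n)
      atTop (𝓝 (green z w)) := by
  obtain ⟨l, -, hl⟩ := h.exists_tendsto z w
  rwa [green, hl.limUnder_eq]

theorem green_nonneg (z : Fin (m + 1) → K) (w : K) : 0 ≤ green z w :=
  ge_of_tendsto' (h.tendsto_green z w) fun n => div_nonneg Real.posLog_nonneg (by positivity)

theorem green_le (z : Fin (m + 1) → K) (w : K) : green z w ≤ logMax z w + Real.log A := by
  obtain ⟨l, hl1, hl2⟩ := h.exists_tendsto z w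
  rw [← tendsto_nhds_unique hl2 (h.tendsto_green z w)]
  simpa using (h.antitone_logMax z w).le_of_tendsto hl1 0

theorem green_evalP (z : Fin (m + 1) → K) (w : K) :
    green z (evalP z w) = (m + 2 : ℕ) * green z w := by
  have h1 := ((h.tendsto_green z w).comp (tendsto_add_atTop_nat 1)).const_mul ((m + 2 : ℕ) : ℝ)
  refine tendsto_nhds_unique (h.tendsto_green z (evalP z w)) (h1.congr fun n => ?_)
  simp only [Function.comp_apply, Function.iterate_succ_apply, pow_succ]
  field_simp

theorem green_iterate (z : Fin (m + 1) → K) (w : K) (n : ℕ) :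
    green z ((evalP z)^[n] w) = ((m + 2 : ℕ) : ℝ) ^ n * green z w := by
  induction n with
  | zero => simp
  | succ n ih => rw [Function.iterate_succ_apply', h.green_evalP, ih, pow_succ]; ring

/-- Beyond this radius ‖w‖ > A‖z‖, as `lower` requires, and ‖w‖ > A, which turns ‖w‖^d ≤ A‖P(w)‖
into ‖w‖ ≤ ‖P(w)‖. The escape region is thus forward invariant. -/
theorem norm_le_norm_evalP {z : Fin (m + 1) → K} {w : K} (hw : A ^ 2 * max 1 ‖z‖ < ‖w‖) :
    ‖w‖ ≤ ‖evalP z w‖ ∧ (m + 2 : ℕ) * Real.log ‖w‖ - Real.log A ≤ Real.log ‖evalP z w‖ := by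
  have hA := h.one_le
  have hA0 : 0 < A := by linarith
  have hz : A * ‖z‖ < ‖w‖ := lt_of_le_of_lt
    (mul_le_mul (le_self_pow₀ hA two_ne_zero) (le_max_right _ _) (norm_nonneg _) (by positivity)) hw
  have hAw : A < ‖w‖ := lt_of_le_of_lt (by nlinarith [le_max_left 1 ‖z‖]) hw
  have hw0 : 0 < ‖w‖ := by linarith
  have h1 := h.lower z w hz
  have h2 : ‖w‖ ≤ ‖evalP z w‖ := by
    refine le_of_mul_le_mul_left (le_trans ?_ h1) hA0
    calc A * ‖w‖ ≤ ‖w‖ ^ 2 := by nlinarith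
      _ ≤ _ := pow_le_pow_right₀ (by linarith) (by omega)
  refine ⟨h2, ?_⟩
  have h3 := Real.log_le_log (by positivity) h1
  rw [Real.log_pow, Real.log_mul (by positivity) (by linarith)] at h3
  linarith

theorem log_sub_le_green {z : Fin (m + 1) → K} {w : K} (hw : A ^ 2 * max 1 ‖z‖ < ‖w‖) :
    Real.log ‖w‖ - Real.log A ≤ green z w := by
  have h1 (n : ℕ) : A ^ 2 * max 1 ‖z‖ < ‖(evalP z)^[n] w‖ := by
    induction n with
    | zero => exact hw
    | succ n ih =>
      rw [Function.iterate_succ_apply']; exact ih.trans_le (h.norm_le_norm_evalP ih).1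
  have h2 := h.log_nonneg
  have hm := (Nat.cast_nonneg m : (0:ℝ) ≤ m)
  -- The additive log A makes the induction close: d log A - log A ≥ log A since d ≥ 2.
  have h3 (n : ℕ) : ((m + 2 : ℕ) : ℝ) ^ n * (Real.log ‖w‖ - Real.log A) + Real.log A
      ≤ Real.log ‖(evalP z)^[n] w‖ := by
    induction n with
    | zero => simp
    | succ n ih =>
      rw [Function.iterate_succ_apply']
      refine le_trans ?_ (h.norm_le_norm_evalP (h1 n)).2
      have h4 := mul_le_mul_of_nonneg_left ih (Nat.cast_nonneg (m + 2) : (0:ℝ) ≤ _)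
      rw [pow_succ]
      push_cast at *
      nlinarith
  refine ge_of_tendsto' (h.tendsto_green z w) fun n => ?_
  rw [le_div_iff₀ (by positivity)]
  have h5 : Real.log ‖(evalP z)^[n] w‖ ≤ Real.posLog ‖(evalP z)^[n] w‖ :=
    le_max_right _ _
  linarith [h3 n]

theorem green_crit_le (z : Fin (m + 1) → K) (i : Fin (m + 1)) :
    green z (BifHeight.crit z i) ≤ Real.posLog ‖z‖ + Real.log A := by
  refine (h.green_le _ _).trans ?_
  rw [Real.posLog_eq_log_max_one (norm_nonneg _), logMax, max_eq_right]
  refine le_max_of_le_right ?_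
  refine Fin.cases (by simp [BifHeight.crit]) (fun i => ?_) i
  exact norm_le_pi_norm z i.castSucc

omit h in
theorem green_crit_le_bigG (z : Fin (m + 1) → K) (i : Fin (m + 1)) :
    green z (BifHeight.crit z i) ≤ bigG z :=
  le_ciSup (f := fun i => green z (BifHeight.crit z i)) (Set.finite_range _).bddAbove i

theorem bigG_nonneg (z : Fin (m + 1) → K) : 0 ≤ bigG z :=
  (h.green_nonneg z _).trans (green_crit_le_bigG z 0)

theorem abs_bigG_sub_le (z : Fin (m + 1) → K) :
    |bigG z - Real.posLog ‖z‖| ≤ 3 * Real.log A := by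
  have hA := h.one_le
  have hA0 : 0 < A := by linarith
  have hl := h.log_nonneg
  rw [abs_le]
  constructor
  swap
  · have : bigG z ≤ Real.posLog ‖z‖ + Real.log A := ciSup_le fun i => h.green_crit_le z i
    linarith
  by_cases hz : ‖z‖ ≤ A ^ 3
  · have : Real.posLog ‖z‖ ≤ 3 * Real.log A := by
      rw [Real.posLog_eq_log_max_one (norm_nonneg _)]
      refine (Real.log_le_log (by positivity) (max_le (one_le_pow₀ hA) hz)).trans ?_
      rw [Real.log_pow]; norm_num
    linarith [h.bigG_nonneg z]
  push Not at hz
  have hz1 : 1 < ‖z‖ := (one_le_pow₀ hA).trans_lt hz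
  obtain ⟨i, hi⟩ := h.crit z
  -- ‖z‖ > A³ puts this critical value in the escape region: ‖P(cᵢ)‖ ≥ ‖z‖² / A > A²‖z‖. Then G ≥
  -- g(P(cᵢ)) / d ≥ log ‖z‖ - (2/d) log A.
  have h1 : A ^ 2 * max 1 ‖z‖ < ‖evalP z (BifHeight.crit z i)‖ := by
    rw [max_eq_right hz1.le]
    refine lt_of_mul_lt_mul_left (lt_of_lt_of_le ?_ hi) hA0.le
    calc A * (A ^ 2 * ‖z‖) = A ^ 3 * ‖z‖ := by ring
      _ < ‖z‖ ^ 2 := by rw [pow_two]; gcongr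
      _ ≤ _ := pow_le_pow_right₀ hz1.le (by omega)
  have h2 := h.log_sub_le_green h1
  rw [h.green_evalP] at h2
  have h3 := Real.log_le_log (by positivity) hi
  have h4 : ‖evalP z (BifHeight.crit z i)‖ ≠ 0 := by
    have : 0 < A ^ 2 * max 1 ‖z‖ := by positivity
    linarith
  rw [Real.log_pow, Real.log_mul hA0.ne' h4] at h3
  have h5 := green_crit_le_bigG z i
  have h6 : Real.posLog ‖z‖ = Real.log ‖z‖ :=
    Real.posLog_eq_log (by rw [abs_of_nonneg (norm_nonneg _)]; exact hz1.le)
  rw [h6]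
  have hd : (2 : ℝ) ≤ ((m + 2 : ℕ) : ℝ) := by push_cast; linarith [(Nat.cast_nonneg m : (0:ℝ) ≤ m)]
  by_contra hc
  push Not at hc
  nlinarith

/-- Points with vanishing Green function are bounded. -/
theorem norm_le_of_green_eq_zero {z : Fin (m + 1) → K} {w : K} (hg : green z w = 0) :
    ‖w‖ ≤ A ^ 2 * max 1 ‖z‖ := by
  by_contra! hc
  have hA := h.one_le
  have h1 := h.log_sub_le_green hc
  have h2 : A < ‖w‖ := lt_of_le_of_lt (by nlinarith [le_max_left 1 ‖z‖]) hc
  have h3 := Real.log_lt_log (by linarith) h2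
  linarith

omit h in
/-- For `A = 1`, integrality is preserved by iteration. -/
theorem norm_iterate_le_one (h : EscapeBound K m 1) {z : Fin (m + 1) → K} (hz : ‖z‖ ≤ 1) {w : K}
    (hw : ‖w‖ ≤ 1) (n : ℕ) : ‖(evalP z)^[n] w‖ ≤ 1 := by
  induction n with
  | zero => exact hw
  | succ n ih =>
    rw [Function.iterate_succ_apply']
    refine (h.upper z _).trans ?_
    rw [one_mul]
    exact pow_le_one₀ (by positivity) (max_le ih hz)

theorem green_eq_zero_of_finite {z : Fin (m + 1) → K} {w : K}
    (hf : (Set.range fun n => (evalP z)^[n] w).Finite) : green z w = 0 := by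
  obtain ⟨B, hB⟩ := (hf.image fun y => Real.posLog ‖y‖).bddAbove
  refine le_antisymm ?_ (h.green_nonneg z w)
  refine le_of_tendsto_of_tendsto' (h.tendsto_green z w) (tendsto_const_div_degree_pow m B)
    fun n => ?_
  gcongr
  exact hB ⟨_, ⟨n, rfl⟩, rfl⟩

end EscapeBound

end Escape

/-! ### Polynomial bounds at the places of ℚ. -/

section PlaceNorms

instance charZeroCv : (v : Place) → CharZero (Cv v)
  | none => inferInstanceAs (CharZero ℂ)
  | some p => inferInstanceAs (CharZero ℂ_[(p : ℕ)])

instance isUltrametricDistCv (p : Nat.Primes) : IsUltrametricDist (Cv (some p)) :=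
  inferInstanceAs (IsUltrametricDist ℂ_[(p : ℕ)])

theorem norm_ratCast_none (q : ℚ) : ‖(q : Cv none)‖ = |(q : ℝ)| :=
  Complex.norm_ratCast q

theorem norm_ratCast_some (p : Nat.Primes) (q : ℚ) :
    ‖(q : Cv (some p))‖ = (padicNorm p q : ℝ) := by
  have h : ((algebraMap ℚ_[(p : ℕ)] ℂ_[(p : ℕ)] (q : ℚ_[(p : ℕ)])) : ℂ_[(p : ℕ)]) = (q : ℂ_[(p : ℕ)]) :=
    map_ratCast _ _
  change ‖(q : ℂ_[(p : ℕ)])‖ = _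
  rw [← h, ← Padic.eq_padicNorm]
  exact PadicComplex.norm_extends' (p : ℕ) _

theorem norm_ratCast_some_le_one (p : Nat.Primes) (q : ℚ) (h : ¬ (p : ℕ) ∣ q.den) :
    ‖(q : Cv (some p))‖ ≤ 1 := by
  rw [norm_ratCast_some, ← Padic.eq_padicNorm]
  exact Padic.norm_rat_le_one h

theorem finite_primes_dvd {n : ℕ} (hn : n ≠ 0) : {p : Nat.Primes | (p : ℕ) ∣ n}.Finite := by
  refine Set.Finite.of_finite_image ((Nat.divisors n).finite_toSet.subset ?_)
    Nat.Primes.coe_nat_injective.injOn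
  rintro _ ⟨p, hp, rfl⟩
  simpa [hn] using hp

/-- On the closed unit polydisc over `K`, the polynomials in `S` are bounded by `A`, and a sum of at
most `n` elements of norm at most `B` has norm at most `A * B`. -/
structure PolydiscBound (K : Type*) [NormedField K] [CharZero K] {σ : Type*} (n : ℕ)
    (S : Finset (MvPolynomial σ ℚ)) (A : ℝ) : Prop where
  one_le : 1 ≤ A
  sum : ∀ k ≤ n, ∀ (f : Fin k → K) (B : ℝ), 0 ≤ B → (∀ i, ‖f i‖ ≤ B) → ‖∑ i, f i‖ ≤ A * B
  poly : ∀ F ∈ S, ∀ x : σ → K, (∀ i, ‖x i‖ ≤ 1) → ‖MvPolynomial.aeval x F‖ ≤ A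

theorem PolydiscBound.mono {K : Type*} [NormedField K] [CharZero K] {σ : Type*} {n : ℕ}
    {S : Finset (MvPolynomial σ ℚ)} {A A' : ℝ} (h : PolydiscBound K n S A) (hA : A ≤ A') :
    PolydiscBound K n S A' where
  one_le := h.one_le.trans hA
  sum k hk f B hB hf := (h.sum k hk f B hB hf).trans (by gcongr)
  poly F hF x hx := (h.poly F hF x hx).trans hA

theorem norm_monomial_le {K : Type*} [NormedField K] {σ : Type*} {x : σ → K}
    (hx : ∀ i, ‖x i‖ ≤ 1) (c : K) (s : σ →₀ ℕ) : ‖c * s.prod fun i k => x i ^ k‖ ≤ ‖c‖ := by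
  rw [norm_mul, Finsupp.prod, norm_prod]
  refine mul_le_of_le_one_right (norm_nonneg _) (Finset.prod_le_one (fun _ _ => norm_nonneg _) ?_)
  intro i _
  rw [norm_pow]
  exact pow_le_one₀ (norm_nonneg _) (hx i)

theorem exists_polydiscBound (K : Type*) [NormedField K] [CharZero K] {σ : Type*} (n : ℕ)
    (S : Finset (MvPolynomial σ ℚ)) : ∃ A, PolydiscBound K n S A := by
  have h0 : 0 ≤ ∑ F ∈ S, ∑ s ∈ F.support, ‖algebraMap ℚ K (F.coeff s)‖ := by positivity
  refine ⟨1 + n + ∑ F ∈ S, ∑ s ∈ F.support, ‖algebraMap ℚ K (F.coeff s)‖, ?_, ?_, ?_⟩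
  · have : (0 : ℝ) ≤ n := by positivity
    linarith
  · intro k hk f B hB hf
    have hk' : (k : ℝ) ≤ n := by exact_mod_cast hk
    calc ‖∑ i, f i‖ ≤ ∑ i : Fin k, B := norm_sum_le_of_le _ fun i _ => hf i
      _ = k * B := by simp
      _ ≤ _ := by gcongr; linarith
  · intro F hF x hx
    have h1 : ‖MvPolynomial.aeval x F‖ ≤ ∑ s ∈ F.support, ‖algebraMap ℚ K (F.coeff s)‖ := by
      rw [MvPolynomial.aeval_def, MvPolynomial.eval₂_eq]
      exact norm_sum_le_of_le _ fun s _ => norm_monomial_le hx _ s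
    have h2 := Finset.single_le_sum (f := fun F : MvPolynomial σ ℚ =>
      ∑ s ∈ F.support, ‖algebraMap ℚ K (F.coeff s)‖) (fun _ _ => by positivity) hF
    have : (0 : ℝ) ≤ n := by positivity
    linarith

/-- At a prime dividing no denominator of a coefficient, the ultrametric inequality gives both
bounds with constant 1. -/
theorem finite_not_polydiscBound_one {σ : Type*} (n : ℕ) (S : Finset (MvPolynomial σ ℚ)) :
    {v : Place | ¬ PolydiscBound (Cv v) n S 1}.Finite := by
  have hfin : (⋃ F ∈ S, ⋃ s ∈ F.support, {p : Nat.Primes | (p : ℕ) ∣ (F.coeff s).den}).Finite :=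
    S.finite_toSet.biUnion fun F _ => F.support.finite_toSet.biUnion fun s _ =>
      finite_primes_dvd (F.coeff s).den_ne_zero
  refine ((hfin.image some).insert none).subset ?_
  rintro (_ | p) hv
  · exact Set.mem_insert _ _
  refine Set.mem_insert_of_mem _ ⟨p, ?_, rfl⟩
  by_contra hp
  simp only [Set.mem_iUnion, Set.mem_ofPred_eq, not_exists] at hp
  refine hv ⟨le_rfl, fun k _ f B hB hf => ?_, fun F hF x hx => ?_⟩
  · rw [one_mul]
    exact IsUltrametricDist.norm_sum_le_of_forall_le_of_nonneg hB fun i _ => hf i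
  · rw [MvPolynomial.aeval_def, MvPolynomial.eval₂_eq]
    refine IsUltrametricDist.norm_sum_le_of_forall_le_of_nonneg zero_le_one fun s hs => ?_
    refine (norm_monomial_le hx _ s).trans ?_
    rw [eq_ratCast]
    exact norm_ratCast_some_le_one p _ (hp F hF s hs)

theorem exists_place_polydiscBound {σ : Type*} (n : ℕ) (S : Finset (MvPolynomial σ ℚ)) :
    ∃ A : Place → ℝ, (∀ v, PolydiscBound (Cv v) n S (A v)) ∧ {v | A v ≠ 1}.Finite := by
  classical
  choose A hA using fun v => exists_polydiscBound (Cv v) n S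
  refine ⟨fun v => if PolydiscBound (Cv v) n S 1 then 1 else A v, fun v => ?_,
    (finite_not_polydiscBound_one n S).subset fun v hv h => hv (if_pos h)⟩
  dsimp only
  split_ifs with h
  exacts [h, hA v]

end PlaceNorms

/-! ### Polynomial identities over ℚ behind the escape estimates. -/

section Algebraic

variable {m : ℕ}

theorem crit_eq_cons {K : Type*} [Field K] (z : Fin (m + 1) → K) :
    crit z = Fin.cons 0 fun i => z i.castSucc := rfl

/-- The leading coefficient is 1/d, so d·P_{c,a}(1) is 1 modulo the ideal (c, a). After
homogenising, this bounds P(w) below when w is large compared with (c, a). -/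
theorem exists_one_eq_add_sum (m : ℕ) : ∃ H : Fin (m + 1) → MvPolynomial (Fin (m + 1)) ℚ,
    1 = MvPolynomial.C ((m + 2 : ℕ) : ℚ) * genericEval MvPolynomial.X 1
      + ∑ i, H i * MvPolynomial.X i := by
  have h : 1 - MvPolynomial.C ((m + 2 : ℕ) : ℚ) * genericEval MvPolynomial.X 1 ∈
      Ideal.span (Set.range (MvPolynomial.X : Fin (m + 1) → MvPolynomial (Fin (m + 1)) ℚ)) := by
    rw [← Set.image_univ, MvPolynomial.mem_ideal_span_X_image]
    intro s hs
    by_contra! hc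
    obtain rfl : s = 0 := Finsupp.ext fun i => by simpa using hc i
    refine MvPolynomial.mem_support_iff.1 hs ?_
    rw [← MvPolynomial.constantCoeff_eq, map_sub, map_mul, map_genericEval]
    have h2 : ((m + 2 : ℕ) : ℚ) ≠ 0 := by positivity
    simp only [map_one, MvPolynomial.constantCoeff_C, MvPolynomial.constantCoeff_X, genericEval,
      one_pow, mul_one]
    rw [Finset.sum_eq_zero]
    · simp only [one_div, Algebra.algebraMap_self, RingHom.id_apply, add_zero]
      rw [zero_pow (by omega), add_zero, mul_inv_cancel₀ h2, sub_self]
    · intro j hj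
      rw [Finset.sum_eq_zero, mul_zero]
      intro t ht
      have := (Finset.mem_powersetCard.1 ht).2
      have := (Finset.mem_Icc.1 hj).2
      exact Finset.prod_eq_zero (Finset.card_pos.1 (by omega)).choose_spec rfl
  obtain ⟨H, hH⟩ := Ideal.mem_span_range_iff_exists_fun.1 h
  exact ⟨H, by rw [hH]; ring⟩

/-- By `eq_zero_of_evalP_crit_eq_zero` the critical values have only the origin as common zero over
ℚ̄; the Nullstellensatz then puts each coordinate in the radical of the ideal they generate over ℚ.
-/
theorem exists_X_pow_eq_sum (m : ℕ) (j : Fin (m + 1)) :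
    ∃ (N : ℕ) (Q : Fin (m + 1) → MvPolynomial (Fin (m + 1)) ℚ),
      MvPolynomial.X j ^ N = ∑ i, Q i * genericEval MvPolynomial.X
        ((Fin.cons 0 fun i => MvPolynomial.X i.castSucc :
          Fin (m + 1) → MvPolynomial (Fin (m + 1)) ℚ) i) := by
  set F : Fin (m + 1) → MvPolynomial (Fin (m + 1)) ℚ := fun i => genericEval MvPolynomial.X
        ((Fin.cons 0 fun i => MvPolynomial.X i.castSucc :
          Fin (m + 1) → MvPolynomial (Fin (m + 1)) ℚ) i) with hF
  have h : MvPolynomial.X j ∈ (Ideal.span (Set.range F)).radical := by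
    rw [← MvPolynomial.vanishingIdeal_zeroLocus_eq_radical (K := Qbar)]
    rw [MvPolynomial.mem_vanishingIdeal_iff]
    intro z hz
    have : z = 0 := by
      refine eq_zero_of_evalP_crit_eq_zero z fun i => ?_
      rw [← hz (F i) (Ideal.subset_span ⟨i, rfl⟩), evalP_eq_genericEval]
      change _ = (MvPolynomial.aeval z).toRingHom _
      rw [map_genericEval]
      congr 1
      · ext; simp
      · refine Fin.cases ?_ (fun i => ?_) i <;> simp [crit_eq_cons]
    simp [this]
  obtain ⟨N, hN⟩ := h
  obtain ⟨Q, hQ⟩ := Ideal.mem_span_range_iff_exists_fun.1 hN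
  exact ⟨N, Q, hQ.symm⟩

end Algebraic

/-! ### The escape estimates at all places. -/

section EscapeBounds

variable {K : Type*} [NormedField K] [CharZero K] {m : ℕ}

omit [CharZero K] in
theorem exists_norm_apply_eq (z : Fin (m + 1) → K) : ∃ j, ‖z j‖ = ‖z‖ := by
  obtain ⟨j, hj⟩ := Finite.exists_max fun j => ‖z j‖
  exact ⟨j, le_antisymm (norm_le_pi_norm z j) ((pi_norm_le_iff_of_nonneg (norm_nonneg _)).2 hj)⟩

theorem evalP_eq_pow_mul {t : K} (ht : t ≠ 0) (z : Fin (m + 1) → K) (w : K) :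
    evalP z w = t ^ (m + 2) * evalP (fun i => t⁻¹ * z i) (t⁻¹ * w) := by
  rw [← evalP_smul]
  simp only [mul_inv_cancel_left₀ ht]

theorem aeval_genericEval {σ : Type*} (x : σ → K) (z : Fin (m + 1) → MvPolynomial σ ℚ)
    (w : MvPolynomial σ ℚ) : MvPolynomial.aeval x (genericEval z w) =
      evalP (fun i => MvPolynomial.aeval x (z i)) (MvPolynomial.aeval x w) := by
  rw [evalP_eq_genericEval]
  exact map_genericEval (MvPolynomial.aeval x).toRingHom z w

omit [CharZero K] in
theorem norm_inv_mul_le_one {t x : K} (h : ‖x‖ ≤ ‖t‖) : ‖t⁻¹ * x‖ ≤ 1 := by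
  rw [norm_mul, norm_inv]
  exact inv_mul_le_one_of_le₀ h (norm_nonneg _)

theorem norm_evalP_le {n : ℕ} {S : Finset (MvPolynomial (Fin (m + 2)) ℚ)} {A : ℝ}
    (h : PolydiscBound K n S A)
    (hS : genericEval (fun i => MvPolynomial.X i.castSucc) (MvPolynomial.X (Fin.last (m + 1))) ∈ S)
    (z : Fin (m + 1) → K) (w : K) : ‖evalP z w‖ ≤ A * max ‖w‖ ‖z‖ ^ (m + 2) := by
  obtain ⟨t, ht⟩ : ∃ t : K, ‖t‖ = max ‖w‖ ‖z‖ := by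
    rcases max_choice ‖w‖ ‖z‖ with hm | hm
    · exact ⟨w, hm.symm⟩
    · obtain ⟨j, hj⟩ := exists_norm_apply_eq z
      exact ⟨z j, hj.trans hm.symm⟩
  have hw : ‖w‖ ≤ ‖t‖ := ht ▸ le_max_left _ _
  have hz (i) : ‖z i‖ ≤ ‖t‖ := (norm_le_pi_norm z i).trans (ht ▸ le_max_right _ _)
  rw [← ht]
  by_cases ht0 : t = 0
  · subst ht0
    have hw0 : w = 0 := by simpa using hw
    have h0 := evalP_smul (0 : K) z w
    have hz0 : (fun i => 0 * z i) = z := funext fun i => by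
      rw [zero_mul, eq_comm, ← norm_le_zero_iff, ← norm_zero (E := K)]
      exact hz i
    rw [hz0, hw0, zero_pow (by omega), zero_mul, zero_mul, ← hw0] at h0
    rw [h0, hw0]
    simp
  rw [evalP_eq_pow_mul ht0, norm_mul, norm_pow, mul_comm]
  gcongr
  have h1 := h.poly _ hS (Fin.snoc (fun i => t⁻¹ * z i) (t⁻¹ * w) : Fin (m + 2) → K) (fun i => by
    refine Fin.lastCases ?_ (fun i => ?_) i
    · simpa using norm_inv_mul_le_one hw
    · simpa using norm_inv_mul_le_one (hz i))
  simpa [aeval_genericEval] using h1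

theorem norm_sum_mul_le {n : ℕ} {S : Finset (MvPolynomial (Fin (m + 1)) ℚ)} {A : ℝ}
    (h : PolydiscBound K n S A) (hn : m + 2 ≤ n) {Q : Fin (m + 1) → MvPolynomial (Fin (m + 1)) ℚ}
    (hQ : ∀ i, Q i ∈ S) {x : Fin (m + 1) → K} (hx : ∀ i, ‖x i‖ ≤ 1) {f : Fin (m + 1) → K}
    {B : ℝ} (hB : 0 ≤ B) (hf : ∀ i, ‖f i‖ ≤ B) :
    ‖∑ i, MvPolynomial.aeval x (Q i) * f i‖ ≤ A * (A * B) := by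
  have hA : 0 ≤ A := zero_le_one.trans h.one_le
  refine h.sum _ (by omega) _ _ (by positivity) fun i => ?_
  rw [norm_mul]
  exact mul_le_mul (h.poly _ (hQ i) x hx) (hf i) (norm_nonneg _) hA

theorem pow_norm_le_norm_evalP {n : ℕ} {S : Finset (MvPolynomial (Fin (m + 1)) ℚ)} {A : ℝ}
    (h : PolydiscBound K n S A) (hn : m + 2 ≤ n) {H : Fin (m + 1) → MvPolynomial (Fin (m + 1)) ℚ}
    (hH : ∀ i, H i ∈ S) (hC : MvPolynomial.C ((m + 2 : ℕ) : ℚ) ∈ S)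
    (h1 : 1 = MvPolynomial.C ((m + 2 : ℕ) : ℚ) * genericEval MvPolynomial.X 1
      + ∑ i, H i * MvPolynomial.X i) (z : Fin (m + 1) → K) (w : K) (hw : A ^ 3 * ‖z‖ < ‖w‖) :
    ‖w‖ ^ (m + 2) ≤ A ^ 3 * ‖evalP z w‖ := by
  have hA := h.one_le
  have hA0 : 0 < A := by linarith
  have hw0 : 0 < ‖w‖ := lt_of_le_of_lt (by positivity) hw
  have hwne : w ≠ 0 := norm_pos_iff.1 hw0
  have hz (i) : ‖z i‖ ≤ ‖w‖ := (norm_le_pi_norm z i).trans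
    ((le_mul_of_one_le_left (norm_nonneg _) (one_le_pow₀ hA)).trans hw.le)
  rw [evalP_eq_pow_mul hwne, norm_mul, norm_pow, inv_mul_cancel₀ hwne]
  set x : Fin (m + 1) → K := fun i => w⁻¹ * z i with hx
  have hx1 (i) : ‖x i‖ ≤ 1 := norm_inv_mul_le_one (hz i)
  have h2 := congrArg (MvPolynomial.aeval x) h1
  rw [map_one, map_add, map_mul, aeval_genericEval, map_sum, map_one] at h2
  simp only [map_mul, MvPolynomial.aeval_X] at h2
  have hxz : ∀ i, ‖x i‖ ≤ ‖w‖⁻¹ * ‖z‖ := fun i => by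
    rw [hx, norm_mul, norm_inv]
    gcongr
    exact norm_le_pi_norm z i
  have h3 := norm_sum_mul_le h hn hH hx1 (by positivity) hxz
  set y := ∑ i, MvPolynomial.aeval x (H i) * x i
  set p := evalP x 1
  have hC' := h.poly _ hC x hx1
  set c := MvPolynomial.aeval x (MvPolynomial.C ((m + 2 : ℕ) : ℚ) : MvPolynomial (Fin (m + 1)) ℚ)
  have h4 : A * (A * (A * (‖w‖⁻¹ * ‖z‖))) < 1 := by
    rw [show A * (A * (A * (‖w‖⁻¹ * ‖z‖))) = ‖w‖⁻¹ * (A ^ 3 * ‖z‖) by ring]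
    exact (inv_mul_lt_one₀ hw0).2 hw
  -- The identity 1 = c·p + y is estimated as a sum of two terms, where ‖y‖ ≤ A²‖z‖/‖w‖. The
  -- hypothesis A³‖z‖ < ‖w‖ prevents y from dominating, so 1 ≤ A²‖p‖.
  have h5 : 1 ≤ A * max (A * ‖p‖) ‖y‖ := by
    have := h.sum 2 (by omega) ![c * p, y] (max (A * ‖p‖) ‖y‖) (by positivity) (by
      rw [Fin.forall_fin_two]
      refine ⟨le_max_of_le_left ?_, le_max_right _ _⟩
      simp only [Matrix.cons_val_zero, norm_mul]
      gcongr)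
    rw [Fin.sum_univ_two] at this
    simpa [← h2] using this
  have h6 : 1 ≤ A * (A * ‖p‖) := by
    rcases max_choice (A * ‖p‖) ‖y‖ with hm | hm
    · rwa [hm] at h5
    · rw [hm] at h5
      have := mul_le_mul_of_nonneg_left h3 hA0.le
      linarith
  have h7 : 1 ≤ A ^ 3 * ‖p‖ := by nlinarith
  calc ‖w‖ ^ (m + 2) ≤ ‖w‖ ^ (m + 2) * (A ^ 3 * ‖p‖) := le_mul_of_one_le_right (by positivity) h7
    _ = _ := by ring

theorem exists_pow_norm_le_norm_evalP_crit {n : ℕ} {S : Finset (MvPolynomial (Fin (m + 1)) ℚ)}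
    {A : ℝ} (h : PolydiscBound K n S A) (hn : m + 2 ≤ n) {N : Fin (m + 1) → ℕ}
    {Q : Fin (m + 1) → Fin (m + 1) → MvPolynomial (Fin (m + 1)) ℚ} (hQ : ∀ j i, Q j i ∈ S)
    (h1 : ∀ j, MvPolynomial.X j ^ N j = ∑ i, Q j i * genericEval MvPolynomial.X
        ((Fin.cons 0 fun i => MvPolynomial.X i.castSucc :
          Fin (m + 1) → MvPolynomial (Fin (m + 1)) ℚ) i)) (z : Fin (m + 1) → K) :
    ∃ i, ‖z‖ ^ (m + 2) ≤ A ^ 3 * ‖evalP z (crit z i)‖ := by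
  have hA := h.one_le
  have hA0 : 0 < A := by linarith
  obtain ⟨j, hj⟩ := exists_norm_apply_eq z
  by_cases hz0 : z j = 0
  · refine ⟨0, ?_⟩
    rw [← hj, hz0, norm_zero, zero_pow (by omega)]
    positivity
  set t := z j with ht
  set x : Fin (m + 1) → K := fun i => t⁻¹ * z i with hx
  have hx1 (i) : ‖x i‖ ≤ 1 := norm_inv_mul_le_one (hj ▸ norm_le_pi_norm z i)
  have h2 := congrArg (MvPolynomial.aeval x) (h1 j)
  have hcrit (i) : MvPolynomial.aeval x ((Fin.cons 0 fun i => MvPolynomial.X i.castSucc :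
      Fin (m + 1) → MvPolynomial (Fin (m + 1)) ℚ) i) = crit x i := by
    refine Fin.cases ?_ (fun i => ?_) i <;> simp [crit_eq_cons]
  simp only [map_sum, map_mul, map_pow, MvPolynomial.aeval_X, aeval_genericEval, hcrit] at h2
  -- Dividing by the coordinate of largest norm makes that coordinate 1, so the exponent from the
  -- Nullstellensatz drops out.
  have hxj : x j = 1 := inv_mul_cancel₀ hz0
  rw [hxj, one_pow] at h2
  obtain ⟨i, hi⟩ := Finite.exists_max fun i => ‖evalP x (crit x i)‖
  have h3 := norm_sum_mul_le h hn (hQ j) hx1 (norm_nonneg _) hi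
  rw [← h2, norm_one] at h3
  refine ⟨i, ?_⟩
  have hci : t⁻¹ * crit z i = crit x i := by
    refine Fin.cases ?_ (fun i => ?_) i <;> simp [crit_eq_cons, hx]
  rw [evalP_eq_pow_mul hz0 z, hci, norm_mul, norm_pow, ← hj]
  have h7 : 1 ≤ A ^ 3 * ‖evalP x (crit x i)‖ := by
    nlinarith [norm_nonneg (evalP x (crit x i))]
  calc ‖t‖ ^ (m + 2) ≤ ‖t‖ ^ (m + 2) * (A ^ 3 * ‖evalP x (crit x i)‖) :=
        le_mul_of_one_le_right (by positivity) h7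
    _ = _ := by ring

/-- The family `P_{c,a}` satisfies uniform escape estimates at every place, with constant `1` at
all but finitely many places. -/
theorem exists_escapeBound (m : ℕ) : ∃ A : Place → ℝ,
    (∀ v, EscapeBound (Cv v) m (A v)) ∧ {v | A v ≠ 1}.Finite := by
  classical
  obtain ⟨H, hH⟩ := exists_one_eq_add_sum m
  choose N Q hQ using exists_X_pow_eq_sum m
  obtain ⟨A₁, hA₁, hf₁⟩ := exists_place_polydiscBound (m + 2) {(genericEval
    (fun i => MvPolynomial.X i.castSucc) (MvPolynomial.X (Fin.last (m + 1))) :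
      MvPolynomial (Fin (m + 2)) ℚ)}
  obtain ⟨A₂, hA₂, hf₂⟩ := exists_place_polydiscBound (m + 2)
    (insert (MvPolynomial.C ((m + 2 : ℕ) : ℚ)) (Finset.univ.image H ∪
      Finset.univ.image fun p : Fin (m + 1) × Fin (m + 1) => Q p.1 p.2))
  refine ⟨fun v => max (A₁ v) (A₂ v) ^ 3, fun v => ?_, (hf₁.union hf₂).subset fun v hv => ?_⟩
  · have h1 := (hA₁ v).mono (le_max_left (A₁ v) (A₂ v))
    have h2 := (hA₂ v).mono (le_max_right (A₁ v) (A₂ v))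
    refine ⟨one_le_pow₀ h1.one_le, fun z w => ?_, ?_, ?_⟩
    · refine (norm_evalP_le h1 (by simp) z w).trans ?_
      gcongr
      exact le_self_pow₀ h1.one_le (by norm_num)
    · exact pow_norm_le_norm_evalP h2 le_rfl (fun i => by simp) (by simp) hH
    · exact exists_pow_norm_le_norm_evalP_crit h2 le_rfl
        (fun j i => by
          refine Finset.mem_insert_of_mem (Finset.mem_union_right _ ?_)
          exact Finset.mem_image_of_mem (fun p : Fin (m + 1) × Fin (m + 1) => Q p.1 p.2)
            (Finset.mem_univ (j, i))) hQ
  · by_contra hc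
    rw [Set.mem_union, Set.mem_ofPred_eq, Set.mem_ofPred_eq, not_or, not_not, not_not] at hc
    exact hv (by simp [hc.1, hc.2])

end EscapeBounds

/-! ### Galois orbits in ℚ̄ⁿ. -/

instance isAlgebraicQbar : Algebra.IsAlgebraic ℚ Qbar := by
  have h : Algebra.IsAlgebraic ℚ (AlgebraicClosure ℚ) := by
    exact AlgebraicClosure.isAlgebraic ℚ
  exact h

instance isAlgClosureQbar : IsAlgClosure ℚ Qbar := ⟨inferInstance, inferInstance⟩

instance normalQbar : Normal ℚ Qbar := IsAlgClosure.normal ℚ Qbar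

instance isGaloisQbar : IsGalois ℚ Qbar := ⟨⟩

section Orbits

variable {n k : ℕ}

theorem mem_orbit_self (x : Fin n → Qbar) : x ∈ orbit x := ⟨AlgEquiv.refl, rfl⟩

theorem galois_mem_orbit {x y : Fin n → Qbar} (hy : y ∈ orbit x) (τ : Qbar ≃ₐ[ℚ] Qbar) :
    (fun i => τ (y i)) ∈ orbit x := by
  obtain ⟨ρ, rfl⟩ := hy
  exact ⟨ρ.trans τ, rfl⟩

theorem orbit_finite (x : Fin n → Qbar) : (orbit x).Finite := by
  refine (Set.Finite.pi' fun i => (rootSet_finite (minpoly ℚ (x i)) Qbar)).subset ?_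
  rintro _ ⟨τ, rfl⟩ i
  refine (mem_rootSet_of_ne (minpoly.ne_zero (Algebra.IsIntegral.isIntegral (x i)))).2 ?_
  change aeval ((τ : Qbar →ₐ[ℚ] Qbar) (x i)) _ = 0
  rw [aeval_algHom_apply, minpoly.aeval, map_zero]

theorem orbit_ncard_pos (x : Fin n → Qbar) : 0 < ((orbit x).ncard : ℝ) := by
  exact_mod_cast (Set.ncard_pos (orbit_finite x)).2 ⟨x, mem_orbit_self x⟩

theorem finsum_orbit (x : Fin n → Qbar) (f : (Fin n → Qbar) → ℝ) :
    ∑ᶠ y ∈ orbit x, f y = ∑ y ∈ (orbit_finite x).toFinset, f y := by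
  rw [← finsum_mem_coe_finset, Set.Finite.coe_toFinset]

theorem finsum_orbit_nonneg (x : Fin n → Qbar) {f : (Fin n → Qbar) → ℝ} (hf : ∀ y, 0 ≤ f y) :
    0 ≤ ∑ᶠ y ∈ orbit x, f y := by
  rw [finsum_orbit]
  exact Finset.sum_nonneg fun y _ => hf y

/-- A Galois equivariant map preserves averages over orbits. -/
theorem average_orbit (x : Fin n → Qbar) (F : (Fin n → Qbar) → (Fin k → Qbar))
    (hF : ∀ (τ : Qbar ≃ₐ[ℚ] Qbar) y, F (fun i => τ (y i)) = fun i => τ (F y i))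
    (f : (Fin k → Qbar) → ℝ) :
    (1 / ((orbit (F x)).ncard : ℝ)) * ∑ᶠ u ∈ orbit (F x), f u =
      (1 / ((orbit x).ncard : ℝ)) * ∑ᶠ y ∈ orbit x, f (F y) := by
  classical
  have himg : (orbit_finite (F x)).toFinset = (orbit_finite x).toFinset.image F := by
    ext u
    simp only [Set.Finite.mem_toFinset, Finset.mem_image]
    constructor
    · rintro ⟨τ, rfl⟩
      exact ⟨_, ⟨τ, rfl⟩, hF τ x⟩
    · rintro ⟨_, ⟨τ, rfl⟩, rfl⟩
      exact ⟨τ, (hF τ x).symm⟩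
  -- By equivariance τ carries the fibre over F x bijectively onto the fibre over τ(F x), so all
  -- fibres have equal size.
  have hfib : ∀ u ∈ (orbit_finite x).toFinset.image F,
      ((orbit_finite x).toFinset.filter fun y => F y = u).card =
        ((orbit_finite x).toFinset.filter fun y => F y = F x).card := by
    intro u hu
    rw [← himg, Set.Finite.mem_toFinset] at hu
    obtain ⟨τ, rfl⟩ := hu
    symm
    refine Finset.card_bij' (fun y _ => fun i => τ (y i)) (fun y _ => fun i => τ.symm (y i))
      ?_ ?_ ?_ ?_
    · intro y hy
      rw [Finset.mem_filter, Set.Finite.mem_toFinset] at hy ⊢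
      exact ⟨galois_mem_orbit hy.1 τ, by rw [hF, hy.2]⟩
    · intro y hy
      rw [Finset.mem_filter, Set.Finite.mem_toFinset] at hy ⊢
      exact ⟨galois_mem_orbit hy.1 τ.symm, by rw [hF, hy.2]; simp⟩
    · intro y _; simp
    · intro y _; simp
  have hcard := Finset.card_eq_sum_card_image F (orbit_finite x).toFinset
  rw [Finset.sum_congr rfl hfib, Finset.sum_const, smul_eq_mul] at hcard
  have hpos : 0 < (orbit_finite x).toFinset.card :=
    Finset.card_pos.2 ⟨x, (orbit_finite x).mem_toFinset.2 (mem_orbit_self x)⟩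
  rw [finsum_orbit, finsum_orbit, Finset.sum_comp f F, Set.ncard_eq_toFinset_card _ (orbit_finite x),
    Set.ncard_eq_toFinset_card _ (orbit_finite (F x)), himg, hcard,
    Finset.sum_congr rfl fun u hu => congrArg (· • f u) (hfib u hu), ← Finset.smul_sum]
  rw [hcard] at hpos
  have h1 := (Nat.pos_of_mul_pos_right hpos).ne'
  have h2 := (Nat.pos_of_mul_pos_left hpos).ne'
  rw [nsmul_eq_mul]
  push_cast
  field_simp

end Orbits

/-! ### Integrality and absolute values. -/

section Integrality

theorem norm_le_one_of_isIntegral {L : Type*} [NormedField L] [IsUltrametricDist L] {x : L}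
    (hx : IsIntegral ℤ x) : ‖x‖ ≤ 1 := by
  have h : IsIntegral (NormedField.valuation (K := L)).integer x := hx.tower_top
  exact (Valuation.integer.integers (NormedField.valuation (K := L))).mem_of_integral h

/-- Some nonzero integer multiple N·x is integral, and |N|_p = 1 at every prime p not dividing N. -/
theorem finite_one_lt_norm (ι : Embeddings) (x : Qbar) : {v : Place | ¬ ‖ι v x‖ ≤ 1}.Finite := by
  obtain ⟨N, hN, hx⟩ := ((IsFractionRing.isAlgebraic_iff ℤ ℚ Qbar).2
    (Algebra.IsAlgebraic.isAlgebraic x)).exists_integral_multiple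
  refine (((finite_primes_dvd (Int.natAbs_ne_zero.2 hN)).image some).insert none).subset ?_
  rintro (_ | p) hv
  · exact Set.mem_insert _ _
  refine Set.mem_insert_of_mem _ ⟨p, ?_, rfl⟩
  by_contra hp
  have h1 := norm_le_one_of_isIntegral (hx.map ((ι (some p)).toIntAlgHom))
  have h2 : ‖((N : ℚ) : Cv (some p))‖ = 1 := by
    rw [norm_ratCast_some, (padicNorm.int_eq_one_iff N).2 (by rwa [Int.natCast_dvd]), Rat.cast_one]
  rw [map_zsmul, zsmul_eq_mul, norm_mul, ← Rat.cast_intCast, h2, one_mul] at h1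
  exact hv h1

theorem finite_one_lt_norm_orbit (ι : Embeddings) {n : ℕ} (x : Fin n → Qbar) :
    {v : Place | ¬ ∀ y ∈ orbit x, ‖fun i => ι v (y i)‖ ≤ 1}.Finite := by
  refine ((orbit_finite x).biUnion fun y _ => Set.finite_iUnion fun i =>
    finite_one_lt_norm ι (y i)).subset fun v hv => ?_
  by_contra hc
  simp only [Set.mem_iUnion, Set.mem_ofPred_eq, not_exists, not_not] at hc
  exact hv fun y hy => (pi_norm_le_iff_of_nonneg zero_le_one).2 fun i => hc y hy i

/-- An algebraic number all of whose conjugates are integral at all primes is an algebraic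
integer. -/
theorem isIntegral_of_norm_le_one (ι : Embeddings) (x : Qbar)
    (h : ∀ (p : Nat.Primes) (τ : Qbar ≃ₐ[ℚ] Qbar), ‖ι (some p) (τ x)‖ ≤ 1) : IsIntegral ℤ x := by
  have hx : IsIntegral ℚ x := Algebra.IsIntegral.isIntegral x
  have hnorm (p : Nat.Primes) (k : ℕ) : ‖((minpoly ℚ x).coeff k : Cv (some p))‖ ≤ 1 := by
    set O := (NormedField.valuation (K := Cv (some p))).integer
    -- The minimal polynomial splits into factors X - τ(x), whose images have coefficients in the
    -- valuation ring. Hence no prime divides a denominator of its coefficients.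
    have hl : (minpoly ℚ x).map ((ι (some p)).comp (algebraMap ℚ Qbar)) ∈ lifts O.subtype := by
      rw [← Polynomial.map_map, (IsAlgClosed.splits ((minpoly ℚ x).map (algebraMap ℚ Qbar))).eq_prod_roots_of_monic
        ((minpoly.monic hx).map _), Polynomial.map_multiset_prod, Multiset.map_map]
      refine Subsemiring.multiset_prod_mem _ _ fun q hq => ?_
      obtain ⟨r, hr, rfl⟩ := Multiset.mem_map.1 hq
      obtain ⟨τ, rfl⟩ : ∃ τ : Qbar ≃ₐ[ℚ] Qbar, τ x = r := by
        refine minpoly.exists_algEquiv_of_root' hx.isAlgebraic ?_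
        rw [aeval_def, ← eval_map]
        exact (mem_roots'.1 hr).2
      refine ⟨X - C ⟨ι (some p) (τ x), ?_⟩, ?_⟩
      · simp [O]
      · exact h p τ
    obtain ⟨c, hc⟩ := (lifts_iff_coeff_lifts _).1 hl k
    rw [coeff_map, eq_ratCast] at hc
    rw [← hc]
    exact c.2
  have hint : minpoly ℚ x ∈ lifts (algebraMap ℤ ℚ) := by
    refine (lifts_iff_coeff_lifts _).2 fun k => ⟨((minpoly ℚ x).coeff k).num, ?_⟩
    refine (Rat.den_eq_one_iff _).1 ?_
    by_contra hden
    obtain ⟨p, hp, hdvd⟩ := Nat.exists_prime_and_dvd hden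
    have := Fact.mk hp
    have h1 : (padicNorm p ((minpoly ℚ x).coeff k) : ℝ) ≤ 1 :=
      norm_ratCast_some ⟨p, hp⟩ _ ▸ hnorm ⟨p, hp⟩ k
    rw [← Padic.eq_padicNorm, Padic.norm_rat_le_one_iff_padicValuation_le_one,
      Rat.padicValuation_le_one_iff] at h1
    exact h1 hdvd
  obtain ⟨q, hq, -, hmon⟩ := lifts_and_natDegree_eq_and_monic hint (minpoly.monic hx)
  refine ⟨q, hmon, ?_⟩
  have := minpoly.aeval ℚ x
  rw [← hq, aeval_map_algebraMap] at this
  exact this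

end Integrality

/-! ### The product formula. -/

section ProductFormula

theorem finite_norm_ratCast_ne_one {q : ℚ} (hq : q ≠ 0) :
    (Function.support fun v : Place => Real.log ‖(q : Cv v)‖).Finite := by
  refine ((((finite_primes_dvd q.den_ne_zero).union (finite_primes_dvd q⁻¹.den_ne_zero)).image
    some).insert none).subset ?_
  rintro (_ | p) hv
  · exact Set.mem_insert _ _
  refine Set.mem_insert_of_mem _ ⟨p, ?_, rfl⟩
  by_contra hp
  rw [Set.mem_union, not_or] at hp
  have h1 := norm_ratCast_some_le_one p q hp.1
  have h2 := norm_ratCast_some_le_one p q⁻¹ hp.2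
  rw [Rat.cast_inv, norm_inv] at h2
  have h3 : 0 < ‖(q : Cv (some p))‖ := norm_pos_iff.2 (Rat.cast_ne_zero.2 hq)
  refine hv ?_
  dsimp only
  rw [le_antisymm h1 ((inv_le_one₀ h3).1 h2), Real.log_one]

theorem finsum_log_norm_mul {q r : ℚ} (hq : q ≠ 0) (hr : r ≠ 0) :
    ∑ᶠ v : Place, Real.log ‖((q * r : ℚ) : Cv v)‖ =
      ∑ᶠ v : Place, Real.log ‖(q : Cv v)‖ + ∑ᶠ v : Place, Real.log ‖(r : Cv v)‖ := by
  rw [← finsum_add_distrib (finite_norm_ratCast_ne_one hq) (finite_norm_ratCast_ne_one hr)]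
  refine finsum_congr fun v => ?_
  rw [Rat.cast_mul, norm_mul, Real.log_mul]
  · exact norm_ne_zero_iff.2 (Rat.cast_ne_zero.2 hq)
  · exact norm_ne_zero_iff.2 (Rat.cast_ne_zero.2 hr)

theorem finsum_log_norm_natCast (n : ℕ) (hn : n ≠ 0) :
    ∑ᶠ v : Place, Real.log ‖((n : ℚ) : Cv v)‖ = 0 := by
  classical
  induction n using Nat.recOnMul with
  | zero => exact absurd rfl hn
  | one => simp
  | prime ℓ hℓ =>
    let q : Nat.Primes := ⟨ℓ, hℓ⟩
    have hsub : (Function.support fun v : Place => Real.log ‖((ℓ : ℚ) : Cv v)‖) ⊆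
        ({none, some q} : Finset Place) := by
      rintro (_ | p) hv
      · simp
      rw [Function.mem_support, norm_ratCast_some] at hv
      by_contra hp
      refine hv ?_
      rw [show padicNorm p ((ℓ : ℕ) : ℚ) = 1 from ?_]
      · simp
      · have := Fact.mk hℓ
        refine padicNorm.padicNorm_of_prime_of_ne fun h => hp ?_
        have : p = q := Subtype.ext h
        simp [this]
    rw [finsum_eq_sum_of_support_subset _ hsub, Finset.sum_pair (by simp), norm_ratCast_none,
      norm_ratCast_some]
    simp [q, padicNorm.padicNorm_p hℓ.one_lt]
  | mul a b ha hb =>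
    have ha0 : a ≠ 0 := left_ne_zero_of_mul hn
    have hb0 : b ≠ 0 := right_ne_zero_of_mul hn
    rw [Nat.cast_mul, finsum_log_norm_mul (by exact_mod_cast ha0) (by exact_mod_cast hb0), ha ha0,
      hb hb0, add_zero]

/-- The product formula for `ℚ`. -/
theorem finsum_log_norm_ratCast {q : ℚ} (hq : q ≠ 0) :
    ∑ᶠ v : Place, Real.log ‖(q : Cv v)‖ = 0 := by
  have hd : (q.den : ℚ) ≠ 0 := by exact_mod_cast q.den_ne_zero
  have h := finsum_log_norm_mul hq hd
  rw [finsum_log_norm_natCast q.den q.den_ne_zero, add_zero, Rat.mul_den_eq_num] at h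
  rw [← h]
  have hn : q.num.natAbs ≠ 0 := by simpa using hq
  rw [← finsum_log_norm_natCast _ hn]
  refine finsum_congr fun v => ?_
  rcases Int.natAbs_eq q.num with h | h <;> rw [h] <;> simp

end ProductFormula

/-! ### Sections of 𝒪(1) at points of the affine chart. -/

section Sections

variable {m : ℕ}

theorem rep_mk_eq {K : Type*} [Field K] {n : ℕ} (W : Fin n → K) (hW : W ≠ 0) :
    ∃ t : K, t ≠ 0 ∧ ∀ i, (Projectivization.mk K W hW).rep i = t * W i := by
  obtain ⟨u, hu⟩ := Projectivization.exists_smul_eq_mk_rep K W hW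
  exact ⟨u, u.ne_zero, fun i => (congrFun hu i).symm⟩

theorem affinePoint_injective : Function.Injective (affinePoint (m := m)) := by
  intro z z' h
  rw [affinePoint, affinePoint, Projectivization.mk_eq_mk_iff'] at h
  obtain ⟨t, ht⟩ := h
  have h0 := congrFun ht 0
  simp at h0
  subst h0
  funext i
  simpa using (congrFun ht i.succ).symm

theorem projMap_affinePoint {L : Type*} [Field L] (f : Qbar →+* L) (z : Fin (m + 1) → Qbar) :
    projMap f (affinePoint z) = Projectivization.mk L (Fin.cons 1 fun i => f (z i))
      (fun h => one_ne_zero (congrFun h 0)) := by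
  rw [affinePoint, projMap, Projectivization.map_mk]
  congr 1
  funext i
  refine Fin.cases ?_ (fun i => ?_) i <;> simp [coordMap]

theorem projOrbit_affinePoint (z : Fin (m + 1) → Qbar) :
    projOrbit (affinePoint z) = affinePoint '' orbit z := by
  rw [projOrbit, orbit, ← Set.range_comp]
  congr 1
  funext τ
  exact projMap_affinePoint _ z

/-- The value of the linear form with coefficients `s` at `(1, c, a)`. -/
noncomputable def affineForm {K : Type*} [Field K] (s : Fin (m + 2) → ℚ) (z : Fin (m + 1) → K) : K :=
  s 0 + ∑ i, (s (Fin.succ i) : K) * z i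

theorem map_affineForm {K L : Type*} [Field K] [Field L] [CharZero K] (f : K →+* L)
    (s : Fin (m + 2) → ℚ) (z : Fin (m + 1) → K) :
    f (affineForm s z) = affineForm s fun i => f (z i) := by
  simp [affineForm]

theorem sectionNorm_projMap_affinePoint {L : Type*} [NormedField L] (f : Qbar →+* L)
    (s : Fin (m + 2) → ℚ) (z : Fin (m + 1) → Qbar) :
    sectionNorm s (projMap f (affinePoint z)) =
      ‖f (affineForm s z)‖ * Real.exp (-bigG fun i => f (z i)) := by
  rw [projMap_affinePoint]
  obtain ⟨t, ht, hrep⟩ := rep_mk_eq (Fin.cons 1 fun i => f (z i) : Fin (m + 2) → L)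
    (fun h => one_ne_zero (congrFun h 0))
  rw [sectionNorm, if_pos (by rw [hrep]; simpa using ht), affineSectionNorm, map_affineForm,
    affineForm]
  simp only [hrep, Fin.cons_zero, mul_one, Fin.cons_succ]
  congr 2
  · rw [Fin.sum_univ_succ]
    simp only [Fin.cons_zero, mul_one, Fin.cons_succ]
    rw [div_eq_iff ht, add_mul, Finset.sum_mul]
    congr 1
    exact Finset.sum_congr rfl fun i _ => by ring
  · congr 3
    funext i
    field_simp

theorem nonvanishingOn_iff (s : Fin (m + 2) → ℚ) (z : Fin (m + 1) → Qbar) :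
    NonvanishingOn s (affinePoint z) ↔ ∀ y ∈ orbit z, affineForm s y ≠ 0 := by
  rw [NonvanishingOn, projOrbit_affinePoint, Set.forall_mem_image]
  refine forall₂_congr fun y _ => ?_
  obtain ⟨t, ht, hrep⟩ := rep_mk_eq (Fin.cons 1 y : Fin (m + 2) → Qbar)
    (fun h => one_ne_zero (congrFun h 0))
  have h : ∑ i, (s i : Qbar) * (affinePoint y).rep i = t * affineForm s y := by
    rw [affinePoint, affineForm, mul_add, Finset.mul_sum, Fin.sum_univ_succ]
    simp only [hrep, Fin.cons_zero, Fin.cons_succ]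
    congr 1
    · ring
    · exact Finset.sum_congr rfl fun i _ => by ring
  rw [h, mul_ne_zero_iff, and_iff_right ht]

theorem exists_nonvanishingOn (z : Fin (m + 1) → Qbar) : ∃ s, NonvanishingOn s (affinePoint z) := by
  -- The linear form W₀ vanishes nowhere on the affine chart.
  refine ⟨Fin.cons 1 0, (nonvanishingOn_iff _ z).2 fun y _ => ?_⟩
  simp [affineForm]

theorem ncard_projOrbit (z : Fin (m + 1) → Qbar) :
    (projOrbit (affinePoint z)).ncard = (orbit z).ncard := by
  rw [projOrbit_affinePoint, Set.ncard_image_of_injective _ affinePoint_injective]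

/-- The norm of the value of a linear form at a parameter is rational. -/
theorem exists_ratCast_eq_prod (s : Fin (m + 2) → ℚ) (z : Fin (m + 1) → Qbar) :
    ∃ q : ℚ, (q : Qbar) = ∏ y ∈ (orbit_finite z).toFinset, affineForm s y := by
  have h := (InfiniteGalois.mem_bot_iff_fixed (k := ℚ)
    (∏ y ∈ (orbit_finite z).toFinset, affineForm s y)).2 fun τ => by
    rw [map_prod]
    refine Finset.prod_bij' (fun y _ => fun i => τ (y i)) (fun y _ => fun i => τ.symm (y i))
      ?_ ?_ ?_ ?_ ?_
    · intro y hy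
      rw [Set.Finite.mem_toFinset] at hy ⊢
      exact galois_mem_orbit hy τ
    · intro y hy
      rw [Set.Finite.mem_toFinset] at hy ⊢
      exact galois_mem_orbit hy τ.symm
    · intro y _; simp
    · intro y _; simp
    · intro y _
      exact map_affineForm (τ : Qbar →+* Qbar) s y
  obtain ⟨q, hq⟩ := IntermediateField.mem_bot.1 h
  exact ⟨q, by rw [← hq, eq_ratCast]⟩

variable (ι : Embeddings)

/-- A single q, the product of σ over the orbit, serves all places; this is what lets the product
formula remove the dependence on σ. -/
theorem exists_sectionTerm_eq {s : Fin (m + 2) → ℚ} {z : Fin (m + 1) → Qbar}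
    (hs : NonvanishingOn s (affinePoint z)) : ∃ q : ℚ, q ≠ 0 ∧ ∀ v,
      sectionTerm ι s (affinePoint z) v =
        ∑ᶠ y ∈ orbit z, localG ι v y - Real.log ‖(q : Cv v)‖ := by
  obtain ⟨q, hq⟩ := exists_ratCast_eq_prod s z
  rw [nonvanishingOn_iff] at hs
  have hq0 : q ≠ 0 := by
    rw [← Rat.cast_ne_zero (α := Qbar), hq]
    exact Finset.prod_ne_zero_iff.2 fun y hy => hs y ((orbit_finite z).mem_toFinset.1 hy)
  refine ⟨q, hq0, fun v => ?_⟩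
  rw [← map_ratCast (ι v), hq, map_prod, norm_prod, Real.log_prod, sectionTerm,
    projOrbit_affinePoint, finsum_mem_image affinePoint_injective.injOn, finsum_orbit, finsum_orbit,
    ← Finset.sum_sub_distrib]
  · refine Finset.sum_congr rfl fun y hy => ?_
    have h0 : ‖ι v (affineForm s y)‖ ≠ 0 := by
      rw [norm_ne_zero_iff, _root_.map_ne_zero]
      exact hs y ((orbit_finite z).mem_toFinset.1 hy)
    rw [sectionNorm_projMap_affinePoint, Real.log_mul h0 (Real.exp_ne_zero _), Real.log_exp, localG]
    ring
  · intro y hy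
    rw [norm_ne_zero_iff, _root_.map_ne_zero]
    exact hs y ((orbit_finite z).mem_toFinset.1 hy)

end Sections

/-! ### Heights as averages of local contributions. -/

section Heights

variable (ι : Embeddings) {m : ℕ} {A : Place → ℝ}

theorem localG_eq_zero (hA : ∀ v, EscapeBound (Cv v) m (A v)) {v : Place} (hv : A v = 1)
    {y : Fin (m + 1) → Qbar} (hy : ‖fun i => ι v (y i)‖ ≤ 1) : localG ι v y = 0 := by
  have h := (hA v).abs_bigG_sub_le fun i => ι v (y i)
  rw [hv, Real.log_one, mul_zero, (Real.posLog_eq_zero_iff _).2 (by rwa [abs_norm]), sub_zero] at h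
  exact abs_nonpos_iff.1 h

theorem localG_nonneg (v : Place) (y : Fin (m + 1) → Qbar) : 0 ≤ localG ι v y := by
  obtain ⟨A, hA, -⟩ := exists_escapeBound m
  exact (hA v).bigG_nonneg _

/-- The places at which `c`, `a` or their conjugates are not integral, or the estimates for the
family are not sharp. -/
theorem finite_badPlaces (hf : {v | A v ≠ 1}.Finite) {n : ℕ} (z : Fin n → Qbar) :
    {v : Place | ¬ (A v = 1 ∧ ∀ y ∈ orbit z, ‖fun i => ι v (y i)‖ ≤ 1)}.Finite :=
  (hf.union (finite_one_lt_norm_orbit ι z)).subset fun v hv => by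
    rw [Set.mem_ofPred_eq, not_and_or] at hv
    exact hv

theorem finite_localG_ne_zero (z : Fin (m + 1) → Qbar) :
    {v : Place | ∃ y ∈ orbit z, localG ι v y ≠ 0}.Finite := by
  obtain ⟨A, hA, hf⟩ := exists_escapeBound m
  refine (finite_badPlaces ι hf z).subset fun v ⟨y, hy, hv⟩ hc => hv ?_
  exact localG_eq_zero ι hA hc.1 (hc.2 y hy)

theorem finite_support_finsum_localG (z : Fin (m + 1) → Qbar) :
    (Function.support fun v : Place => ∑ᶠ y ∈ orbit z, localG ι v y).Finite := by
  refine (finite_localG_ne_zero ι z).subset fun v hv => ?_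
  by_contra hc
  refine hv ?_
  dsimp only
  rw [finsum_orbit]
  refine Finset.sum_eq_zero fun y hy => ?_
  by_contra h
  exact hc ⟨y, (orbit_finite z).mem_toFinset.1 hy, h⟩

theorem sum_sectionTerm {s : Fin (m + 2) → ℚ} {z : Fin (m + 1) → Qbar}
    (hs : NonvanishingOn s (affinePoint z)) :
    {v : Place | sectionTerm ι s (affinePoint z) v ≠ 0}.Finite ∧
      ∑ᶠ v : Place, sectionTerm ι s (affinePoint z) v =
        ∑ᶠ v : Place, ∑ᶠ y ∈ orbit z, localG ι v y := by
  obtain ⟨q, hq0, hq⟩ := exists_sectionTerm_eq ι hs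
  have h1 := finite_support_finsum_localG ι z
  have h2 := finite_norm_ratCast_ne_one hq0
  constructor
  · refine (h1.union h2).subset fun v hv => ?_
    by_contra hc
    rw [Set.mem_union, Function.mem_support, Function.mem_support, not_or, not_not, not_not] at hc
    exact hv (by rw [hq, hc.1, hc.2, sub_zero])
  · rw [finsum_congr hq, finsum_sub_distrib h1 h2, finsum_log_norm_ratCast hq0, sub_zero]

theorem hbif_eq (z : Fin (m + 1) → Qbar) :
    hbif ι z = (1 / ((orbit z).ncard : ℝ)) * ∑ᶠ v : Place, ∑ᶠ y ∈ orbit z, localG ι v y := by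
  rw [hbif, bifHeight, ncard_projOrbit,
    (sum_sectionTerm ι (Classical.epsilon_spec (exists_nonvanishingOn z))).2]

theorem finite_support_finsum_posLog {n : ℕ} (x : Fin n → Qbar) :
    (Function.support fun v : Place => ∑ᶠ y ∈ orbit x, Real.posLog ‖fun i => ι v (y i)‖).Finite := by
  refine (finite_one_lt_norm_orbit ι x).subset fun v hv hc => hv ?_
  dsimp only
  rw [finsum_orbit]
  refine Finset.sum_eq_zero fun y hy => (Real.posLog_eq_zero_iff _).2 ?_
  rw [abs_norm]
  exact hc y ((orbit_finite x).mem_toFinset.1 hy)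

theorem hbif_nonneg (z : Fin (m + 1) → Qbar) : 0 ≤ hbif ι z := by
  rw [hbif_eq]
  exact mul_nonneg (by positivity)
    (finsum_nonneg fun v => finsum_orbit_nonneg z fun y => localG_nonneg ι v y)

theorem exists_abs_hbif_sub_le (m : ℕ) :
    ∃ B : ℝ, ∀ z : Fin (m + 1) → Qbar, |hbif ι z - naiveHeight ι z| ≤ B := by
  obtain ⟨A, hA, hf⟩ := exists_escapeBound m
  refine ⟨∑ v ∈ hf.toFinset, 3 * Real.log (A v), fun z => ?_⟩
  have hpos := orbit_ncard_pos z
  rw [hbif_eq, naiveHeight, ← mul_sub, ← finsum_sub_distrib (finite_support_finsum_localG ι z)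
    (finite_support_finsum_posLog ι z)]
  have hv (v : Place) : |∑ᶠ y ∈ orbit z, localG ι v y -
      ∑ᶠ y ∈ orbit z, Real.posLog ‖fun i => ι v (y i)‖| ≤
        (orbit z).ncard * (3 * Real.log (A v)) := by
    rw [finsum_orbit, finsum_orbit, ← Finset.sum_sub_distrib,
      Set.ncard_eq_toFinset_card _ (orbit_finite z), ← nsmul_eq_mul, ← Finset.sum_const]
    exact (Finset.abs_sum_le_sum_abs _ _).trans
      (Finset.sum_le_sum fun y _ => (hA v).abs_bigG_sub_le _)
  rw [finsum_eq_sum_of_support_subset (s := hf.toFinset)]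
  · rw [abs_mul, abs_of_pos (one_div_pos.2 hpos), one_div, inv_mul_le_iff₀ hpos, Finset.mul_sum]
    exact (Finset.abs_sum_le_sum_abs _ _).trans (Finset.sum_le_sum fun v _ => hv v)
  · intro v hne
    rw [Set.Finite.coe_toFinset]
    intro h1
    have := hv v
    rw [h1, Real.log_one, mul_zero, mul_zero] at this
    exact hne (abs_nonpos_iff.1 this)

theorem localG_eq_zero_iff_green {v : Place} {y : Fin (m + 1) → Qbar} : localG ι v y = 0 ↔
    ∀ i, green (fun j => ι v (y j)) (ι v (crit y i)) = 0 := by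
  obtain ⟨A, hA, -⟩ := exists_escapeBound m
  simp only [map_crit]
  constructor
  · intro h i
    exact le_antisymm ((EscapeBound.green_crit_le_bigG _ i).trans h.le) ((hA v).green_nonneg _ _)
  · intro h
    simp [localG, bigG, h]

theorem finsum_orbit_eq_sum {n : ℕ} (z : Fin n → Qbar) (T : Finset Place)
    {f : Place → (Fin n → Qbar) → ℝ} (hf : ∀ v ∉ T, ∀ y ∈ orbit z, f v y = 0) :
    ∑ᶠ v : Place, ∑ᶠ y ∈ orbit z, f v y =
      ∑ v ∈ T, ∑ y ∈ (orbit_finite z).toFinset, f v y := by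
  rw [finsum_eq_sum_of_support_subset (s := T)]
  · simp only [finsum_orbit]
  · intro v hne
    by_contra hv
    refine hne ?_
    dsimp only
    rw [finsum_orbit]
    exact Finset.sum_eq_zero fun y hy => hf v hv y ((orbit_finite z).mem_toFinset.1 hy)

theorem localG_eq_zero_of_notMem {z : Fin (m + 1) → Qbar} {v : Place}
    (hv : v ∉ (finite_localG_ne_zero ι z).toFinset) {y : Fin (m + 1) → Qbar} (hy : y ∈ orbit z) :
    localG ι v y = 0 := by
  by_contra h
  exact hv ((finite_localG_ne_zero ι z).mem_toFinset.2 ⟨y, hy, h⟩)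

/-- The orbit of Pⁿ(cᵢ) varies with n; `average_orbit` replaces it by the fixed orbit of (c, a), so
that the limit in n can be taken term by term. -/
theorem naiveHeight_iterate_crit (z : Fin (m + 1) → Qbar) (i : Fin (m + 1)) (n : ℕ) :
    naiveHeight ι (fun _ : Fin 1 => (evalP z)^[n] (crit z i)) =
      (1 / ((orbit z).ncard : ℝ)) * ∑ᶠ v : Place, ∑ᶠ y ∈ orbit z,
        Real.posLog ‖(evalP fun j => ι v (y j))^[n] (ι v (crit y i))‖ := by
  let F : (Fin (m + 1) → Qbar) → (Fin 1 → Qbar) := fun y _ => (evalP y)^[n] (crit y i)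
  have hF (τ : Qbar ≃ₐ[ℚ] Qbar) (y) : F (fun i => τ (y i)) = fun i => τ (F y i) := by
    funext _
    have := map_evalP_iterate (τ : Qbar →+* Qbar) y (crit y i) n
    rw [map_crit] at this
    exact this.symm
  have h1 (v : Place) := average_orbit z F hF fun u => Real.posLog ‖fun j => ι v (u j)‖
  rw [naiveHeight, mul_finsum, mul_finsum]
  · refine finsum_congr fun v => (h1 v).trans ?_
    simp only [F, pi_norm_const, map_evalP_iterate]

/-- The canonical height of a critical point is the average of local Green functions. -/
theorem canonicalHeight_crit (z : Fin (m + 1) → Qbar) (i : Fin (m + 1)) :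
    canonicalHeight ι z (crit z i) = (1 / ((orbit z).ncard : ℝ)) *
      ∑ᶠ v : Place, ∑ᶠ y ∈ orbit z, green (fun j => ι v (y j)) (ι v (crit y i)) := by
  obtain ⟨A, hA, hf⟩ := exists_escapeBound m
  have hbad := finite_badPlaces ι hf z
  -- Outside one finite set of places, independent of n, all iterates are integral. The sum over v
  -- is thus a fixed finite sum and commutes with the limit.
  have hgood (n : ℕ) (v : Place) (hv : v ∉ hbad.toFinset) (y) (hy : y ∈ orbit z) :
      Real.posLog ‖(evalP fun j => ι v (y j))^[n] (ι v (crit y i))‖ = 0 := by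
    rw [Set.Finite.mem_toFinset, Set.mem_ofPred_eq, not_not] at hv
    rw [Real.posLog_eq_zero_iff, abs_norm]
    refine EscapeBound.norm_iterate_le_one (hv.1 ▸ hA v) (hv.2 y hy) ?_ n
    rw [map_crit]
    refine Fin.cases (by simp [crit]) (fun k => ?_) i
    exact (norm_le_pi_norm (fun j => ι v (y j)) k.castSucc).trans (hv.2 y hy)
  rw [finsum_orbit_eq_sum z hbad.toFinset]
  · refine Tendsto.limUnder_eq ?_
    simp only [naiveHeight_iterate_crit, finsum_orbit_eq_sum z hbad.toFinset (hgood _),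
      mul_div_assoc, Finset.sum_div]
    exact (tendsto_finsetSum _ fun v _ => tendsto_finsetSum _ fun y _ =>
      (hA v).tendsto_green _ _).const_mul _
  · intro v hv y hy
    refine tendsto_nhds_unique ((hA v).tendsto_green _ _) ?_
    simp only [hgood _ v hv y hy, zero_div]
    exact tendsto_const_nhds

end Heights

/-! ### Comparison with Ingram's height and vanishing of local terms. -/

section Ingram

variable (ι : Embeddings) {m : ℕ}

theorem hbif_eq_sum (z : Fin (m + 1) → Qbar) :
    hbif ι z = (1 / ((orbit z).ncard : ℝ)) * ∑ v ∈ (finite_localG_ne_zero ι z).toFinset,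
      ∑ y ∈ (orbit_finite z).toFinset, localG ι v y := by
  rw [hbif_eq, finsum_orbit_eq_sum]
  exact fun v hv y hy => localG_eq_zero_of_notMem ι hv hy

/-- Since 0 ≤ g(cᵢ) ≤ G, the places supporting G support every Green function too. With both heights
summed over the same finite set, they can be compared term by term. -/
theorem ingramHeight_eq_sum (z : Fin (m + 1) → Qbar) :
    ingramHeight ι z = (1 / ((orbit z).ncard : ℝ)) * ∑ v ∈ (finite_localG_ne_zero ι z).toFinset,
      ∑ y ∈ (orbit_finite z).toFinset, ∑ i, green (fun j => ι v (y j)) (ι v (crit y i)) := by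
  simp only [ingramHeight, canonicalHeight_crit, ← Finset.mul_sum]
  rw [Finset.sum_congr rfl fun i _ => finsum_orbit_eq_sum z (finite_localG_ne_zero ι z).toFinset
    fun v hv y hy => (localG_eq_zero_iff_green ι).1 (localG_eq_zero_of_notMem ι hv hy) i,
    Finset.sum_comm]
  congr 1
  exact Finset.sum_congr rfl fun v _ => Finset.sum_comm

theorem localG_le_sum_green (v : Place) (y : Fin (m + 1) → Qbar) :
    localG ι v y ≤ ∑ i, green (fun j => ι v (y j)) (ι v (crit y i)) := by
  obtain ⟨A, hA, -⟩ := exists_escapeBound m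
  simp only [map_crit]
  exact ciSup_le fun i => Finset.single_le_sum
    (f := fun i => green (fun j => ι v (y j)) (crit (fun j => ι v (y j)) i))
    (fun i _ => (hA v).green_nonneg _ _) (Finset.mem_univ i)

theorem sum_green_le_localG (v : Place) (y : Fin (m + 1) → Qbar) :
    ∑ i, green (fun j => ι v (y j)) (ι v (crit y i)) ≤ ((m : ℝ) + 1) * localG ι v y := by
  simp only [map_crit]
  refine (Finset.sum_le_card_nsmul _ _ _ fun i _ =>
    EscapeBound.green_crit_le_bigG (fun j => ι v (y j)) i).trans ?_
  simp [localG]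

theorem hbif_le_ingramHeight (z : Fin (m + 1) → Qbar) : hbif ι z ≤ ingramHeight ι z := by
  rw [hbif_eq_sum, ingramHeight_eq_sum]
  gcongr
  exact localG_le_sum_green ι _ _

theorem ingramHeight_le (z : Fin (m + 1) → Qbar) :
    ingramHeight ι z ≤ ((m : ℝ) + 1) * hbif ι z := by
  rw [hbif_eq_sum, ingramHeight_eq_sum, mul_left_comm]
  refine mul_le_mul_of_nonneg_left ?_ (by positivity)
  rw [Finset.mul_sum]
  refine Finset.sum_le_sum fun v _ => ?_
  rw [Finset.mul_sum]
  exact Finset.sum_le_sum fun y _ => sum_green_le_localG ι v y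

theorem hbif_eq_zero_iff_localG (z : Fin (m + 1) → Qbar) :
    hbif ι z = 0 ↔ ∀ v, ∀ y ∈ orbit z, localG ι v y = 0 := by
  rw [hbif_eq_sum, mul_eq_zero, or_iff_right (one_div_pos.2 (orbit_ncard_pos z)).ne',
    Finset.sum_eq_zero_iff_of_nonneg fun v _ => Finset.sum_nonneg fun y _ => localG_nonneg ι v y]
  constructor
  · intro h v y hy
    by_contra hne
    have := h v ((finite_localG_ne_zero ι z).mem_toFinset.2 ⟨y, hy, hne⟩)
    rw [Finset.sum_eq_zero_iff_of_nonneg fun y _ => localG_nonneg ι v y] at this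
    exact hne (this y ((orbit_finite z).mem_toFinset.2 hy))
  · intro h v _
    exact Finset.sum_eq_zero fun y hy => h v y ((orbit_finite z).mem_toFinset.1 hy)

end Ingram

/-! ### Northcott finiteness in a number field. -/

section Northcott

variable (ι : Embeddings)

/-- A common denominator: N is a product of high powers of the finitely many primes where the bound
exceeds 1. -/
theorem exists_natCast_norm_mul_le (B : Place → ℝ) (hB : {v | ¬ B v ≤ 1}.Finite) :
    ∃ N : ℕ, N ≠ 0 ∧ ∀ p : Nat.Primes, ‖((N : ℚ) : Cv (some p))‖ * B (some p) ≤ 1 := by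
  classical
  have hpow (p : Nat.Primes) : ∃ k : ℕ, ‖(((p ^ k : ℕ) : ℚ) : Cv (some p))‖ * B (some p) ≤ 1 := by
    have h1 : Tendsto (fun k : ℕ => ((p : ℝ)⁻¹) ^ k * B (some p)) atTop (𝓝 (0 * B (some p))) :=
      (tendsto_pow_atTop_nhds_zero_of_lt_one (by positivity)
        (inv_lt_one_of_one_lt₀ (by exact_mod_cast p.2.one_lt))).mul_const _
    rw [zero_mul] at h1
    obtain ⟨k, hk⟩ := (h1.eventually_le_const zero_lt_one).exists
    refine ⟨k, ?_⟩
    push_cast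
    rw [norm_pow, ← Rat.cast_natCast, norm_ratCast_some, padicNorm.padicNorm_p_of_prime]
    simpa using hk
  choose k hk using hpow
  have hfin : {p : Nat.Primes | ¬ B (some p) ≤ 1}.Finite :=
    hB.preimage (Option.some_injective _).injOn
  have hle (p q : Nat.Primes) : ‖((((q : ℕ) ^ k q : ℕ) : ℚ) : Cv (some p))‖ ≤ 1 :=
    norm_ratCast_some_le_one p _ (by simpa using p.2.ne_one)
  refine ⟨∏ p ∈ hfin.toFinset, (p : ℕ) ^ k p,
    Finset.prod_ne_zero_iff.2 fun p _ => pow_ne_zero _ p.2.ne_zero, fun p => ?_⟩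
  rw [Nat.cast_prod, Rat.cast_prod, norm_prod]
  by_cases hp : B (some p) ≤ 1
  · refine (mul_le_mul_of_nonneg_left hp (by positivity)).trans ?_
    rw [mul_one]
    exact Finset.prod_le_one (fun _ _ => norm_nonneg _) fun q _ => hle p q
  · rw [← Finset.mul_prod_erase _ _ (hfin.mem_toFinset.2 hp), mul_right_comm]
    refine mul_le_one₀ (hk p) (by positivity) ?_
    exact Finset.prod_le_one (fun _ _ => norm_nonneg _) fun q _ => hle p q

/-- φ(w) is a root of the minimal polynomial of w, whose roots in L are the j-images of conjugates.
Bounds through the one fixed embedding of ℚ̄ thus control all complex embeddings of K. -/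
theorem exists_conj_eq (K : IntermediateField ℚ Qbar) {L : Type*} [Field L] [CharZero L]
    (j : Qbar →+* L) (φ : K →+* L) (w : K) : ∃ τ : Qbar ≃ₐ[ℚ] Qbar, φ w = j (τ w) := by
  have hx : IsIntegral ℚ (w : Qbar) := Algebra.IsIntegral.isIntegral _
  have h0 : eval₂ (algebraMap ℚ K) w (minpoly ℚ (w : Qbar)) = 0 := by
    refine (algebraMap K Qbar).injective ?_
    rw [hom_eval₂, Subsingleton.elim ((algebraMap K Qbar).comp _) (algebraMap ℚ Qbar), map_zero]
    exact minpoly.aeval ℚ (w : Qbar)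
  have h1 : eval₂ j (φ w) ((minpoly ℚ (w : Qbar)).map (algebraMap ℚ Qbar)) = 0 := by
    rw [eval₂_map, Subsingleton.elim (j.comp (algebraMap ℚ Qbar)) (φ.comp (algebraMap ℚ K)),
      ← hom_eval₂, h0, map_zero]
  rw [(IsAlgClosed.splits ((minpoly ℚ (w : Qbar)).map (algebraMap ℚ Qbar))).eq_prod_roots_of_monic
    ((minpoly.monic hx).map _), eval₂_multiset_prod, Multiset.map_map,
    Multiset.prod_eq_zero_iff] at h1
  obtain ⟨r, hr, h0⟩ := Multiset.mem_map.1 h1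
  obtain ⟨τ, rfl⟩ : ∃ τ : Qbar ≃ₐ[ℚ] Qbar, τ w = r := by
    refine minpoly.exists_algEquiv_of_root' hx.isAlgebraic ?_
    rw [aeval_def, ← eval_map]
    exact (mem_roots'.1 hr).2
  exact ⟨τ, by simpa [sub_eq_zero] using h0⟩

/-- Northcott finiteness in a number field, in terms of bounds at all places. -/
theorem finite_of_norm_le (K : IntermediateField ℚ Qbar) [FiniteDimensional ℚ K] (B : Place → ℝ)
    (hB : {v | ¬ B v ≤ 1}.Finite) :
    {x : Qbar | x ∈ K ∧ ∀ v (τ : Qbar ≃ₐ[ℚ] Qbar), ‖ι v (τ x)‖ ≤ B v}.Finite := by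
  obtain ⟨N, hN, hNp⟩ := exists_natCast_norm_mul_le B hB
  have : NumberField K := { to_charZero := inferInstance, to_finiteDimensional := inferInstance }
  have hfin := (NumberField.Embeddings.finite_of_norm_le K ℂ (N * B none)).image
    (algebraMap K Qbar)
  have hN0 : (N : Qbar) ≠ 0 := by exact_mod_cast hN
  refine Set.Finite.of_finite_image (f := fun x => (N : Qbar) * x) (hfin.subset ?_)
    (mul_right_injective₀ hN0).injOn
  rintro _ ⟨x, ⟨hxK, hx⟩, rfl⟩
  -- N·x is an algebraic integer of K with all complex embeddings bounded by N·B(∞); there are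
  -- finitely many of these.
  refine ⟨N * ⟨x, hxK⟩, ⟨?_, fun φ => ?_⟩, by simp⟩
  · rw [← isIntegral_algebraMap_iff (algebraMap K Qbar).injective]
    refine isIntegral_of_norm_le_one ι _ fun p τ => ?_
    have h1 := hx (some p) τ
    simp only [map_mul, map_natCast, norm_mul]
    refine le_trans ?_ (hNp p)
    rw [Rat.cast_natCast]
    gcongr
    exact h1
  · obtain ⟨τ, hτ⟩ := exists_conj_eq K (ι none : Qbar →+* ℂ) φ ⟨x, hxK⟩
    rw [map_mul, map_natCast, norm_mul, Complex.norm_natCast]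
    exact mul_le_mul_of_nonneg_left ((congrArg norm hτ).trans_le (hx none τ)) (Nat.cast_nonneg N)

end Northcott

/-! ### Vanishing of the height and postcritical finiteness. -/

section PostcriticallyFinite

variable (ι : Embeddings) {m : ℕ}

theorem isPostcriticallyFinite_critPoly_iff (z : Fin (m + 1) → Qbar) :
    IsPostcriticallyFinite (critPoly z) ↔
      ∀ i, (Set.range fun n => (evalP z)^[n] (crit z i)).Finite := by
  constructor
  · intro h i
    refine (h.insert (crit z i)).subset ?_
    rintro _ ⟨_ | n, rfl⟩
    · exact Set.mem_insert _ _
    · exact Set.mem_insert_of_mem _ ⟨crit z i, (isRoot_derivative_critPoly z _).2 ⟨i, rfl⟩, n + 1,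
        by omega, rfl⟩
  · intro h
    refine (Set.finite_iUnion h).subset ?_
    rintro _ ⟨w, hw, n, -, rfl⟩
    obtain ⟨i, rfl⟩ := (isRoot_derivative_critPoly z _).1 hw
    exact Set.mem_iUnion.2 ⟨i, n, rfl⟩

theorem galois_iterate_crit (τ : Qbar ≃ₐ[ℚ] Qbar) (z : Fin (m + 1) → Qbar) (i : Fin (m + 1))
    (n : ℕ) : τ ((evalP z)^[n] (crit z i)) =
      (evalP fun j => τ (z j))^[n] (crit (fun j => τ (z j)) i) := by
  have := map_evalP_iterate (τ : Qbar →+* Qbar) z (crit z i) n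
  rw [map_crit] at this
  exact this

/-- By g(Pⁿ(w)) = dⁿ g(w), vanishing of the Green function persists along the orbit, and points
where it vanishes lie outside the escape region. At good places the resulting radius is 1. -/
theorem exists_bound_iterate_crit (z : Fin (m + 1) → Qbar)
    (h : ∀ v, ∀ y ∈ orbit z, localG ι v y = 0) : ∃ B : Place → ℝ, {v | ¬ B v ≤ 1}.Finite ∧
      ∀ v, ∀ τ : Qbar ≃ₐ[ℚ] Qbar, ∀ i n, ‖ι v (τ ((evalP z)^[n] (crit z i)))‖ ≤ B v := by
  classical
  obtain ⟨A, hA, hf⟩ := exists_escapeBound m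
  have hbad := finite_badPlaces ι hf z
  have hM (v : Place) : ∃ M : ℝ, ∀ y ∈ orbit z, ‖fun j => ι v (y j)‖ ≤ M := by
    obtain ⟨M, hM⟩ := ((orbit_finite z).image fun y => ‖fun j => ι v (y j)‖).bddAbove
    exact ⟨M, fun y hy => hM ⟨y, hy, rfl⟩⟩
  choose M hM using hM
  have hbound (v : Place) (τ : Qbar ≃ₐ[ℚ] Qbar) (i : Fin (m + 1)) (n : ℕ) :
      ‖ι v (τ ((evalP z)^[n] (crit z i)))‖ ≤ A v ^ 2 * max 1 ‖fun j => ι v (τ (z j))‖ := by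
    refine (hA v).norm_le_of_green_eq_zero ?_
    rw [galois_iterate_crit, map_evalP_iterate, (hA v).green_iterate,
      (localG_eq_zero_iff_green ι).1 (h v _ ⟨τ, rfl⟩) i, mul_zero]
  refine ⟨fun v => if v ∈ hbad.toFinset then A v ^ 2 * max 1 (M v) else 1,
    hbad.subset fun v hv => ?_, fun v τ i n => ?_⟩
  · by_contra hc
    exact hv (by dsimp only; rw [if_neg (fun hm => hc (hbad.mem_toFinset.1 hm))])
  · refine (hbound v τ i n).trans ?_
    have hA1 := (hA v).one_le
    dsimp only
    split_ifs with hv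
    · gcongr
      exact hM v _ ⟨τ, rfl⟩
    · rw [Set.Finite.mem_toFinset, Set.mem_ofPred_eq, not_not] at hv
      rw [hv.1, max_eq_left (hv.2 _ ⟨τ, rfl⟩)]
      norm_num

theorem hbif_eq_zero_iff (z : Fin (m + 1) → Qbar) :
    hbif ι z = 0 ↔ IsPostcriticallyFinite (critPoly z) := by
  rw [hbif_eq_zero_iff_localG, isPostcriticallyFinite_critPoly_iff]
  constructor
  · intro h i
    obtain ⟨B, hB, hle⟩ := exists_bound_iterate_crit ι z h
    have : FiniteDimensional ℚ (IntermediateField.adjoin ℚ (Set.range z)) :=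
      IntermediateField.finiteDimensional_adjoin fun x _ => Algebra.IsIntegral.isIntegral x
    refine (finite_of_norm_le ι (IntermediateField.adjoin ℚ (Set.range z)) B hB).subset ?_
    rintro _ ⟨n, rfl⟩
    refine ⟨?_, fun v τ => hle v τ i n⟩
    -- The critical orbit stays in ℚ(c, a), because the polynomial and its critical points are
    -- defined there.
    let y : Fin (m + 1) → IntermediateField.adjoin ℚ (Set.range z) := fun j =>
      ⟨z j, IntermediateField.subset_adjoin ℚ _ ⟨j, rfl⟩⟩
    have := map_evalP_iterate (algebraMap (IntermediateField.adjoin ℚ (Set.range z)) Qbar) y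
      (crit y i) n
    rw [map_crit] at this
    have hmem : (evalP z)^[n] (crit z i) = algebraMap _ Qbar ((evalP y)^[n] (crit y i)) := this.symm
    dsimp only
    rw [hmem]
    exact SetLike.coe_mem _
  · rintro h v _ ⟨τ, rfl⟩
    obtain ⟨A, hA, -⟩ := exists_escapeBound m
    refine (localG_eq_zero_iff_green ι).2 fun i => (hA v).green_eq_zero_of_finite ?_
    refine ((h i).image fun x => ι v (τ x)).subset ?_
    rintro _ ⟨n, rfl⟩
    refine ⟨_, ⟨n, rfl⟩, ?_⟩
    dsimp only
    rw [galois_iterate_crit, map_evalP_iterate]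

end PostcriticallyFinite

end BifHeight

open BifHeight
theorem mainTheorem5 (m : ℕ) (ι : Embeddings) :
    -- the height does not depend on the section used to compute it
    (∀ (z : Fin (m + 1) → Qbar) (s : Fin (m + 2) → ℚ), NonvanishingOn s (affinePoint z) →
      {v : Place | sectionTerm ι s (affinePoint z) v ≠ 0}.Finite ∧
      hbif ι z = (1 / ((projOrbit (affinePoint z)).ncard : ℝ)) *
        ∑ᶠ v : Place, sectionTerm ι s (affinePoint z) v) ∧
    -- the formula for the height; all sums in it are finite
    (∀ z : Fin (m + 1) → Qbar,
      (orbit z).Finite ∧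
      {v : Place | ∃ y ∈ orbit z, localG ι v y ≠ 0}.Finite ∧
      hbif ι z = (1 / ((orbit z).ncard : ℝ)) * ∑ᶠ v : Place, ∑ᶠ y ∈ orbit z, localG ι v y) ∧
    (∀ z : Fin (m + 1) → Qbar, 0 ≤ hbif ι z) ∧
    (∃ B : ℝ, ∀ z : Fin (m + 1) → Qbar, |hbif ι z - naiveHeight ι z| ≤ B) ∧
    (∀ z : Fin (m + 1) → Qbar,
      hbif ι z ≤ ingramHeight ι z ∧ ingramHeight ι z ≤ ((m : ℝ) + 1) * hbif ι z) ∧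
    (∀ z : Fin (m + 1) → Qbar, hbif ι z = 0 ↔ IsPostcriticallyFinite (critPoly z)) := by
  refine ⟨fun z s hs => ?_, fun z => ⟨orbit_finite z, finite_localG_ne_zero ι z, hbif_eq ι z⟩,
    hbif_nonneg ι, exists_abs_hbif_sub_le ι m,
    fun z => ⟨hbif_le_ingramHeight ι z, ingramHeight_le ι z⟩, hbif_eq_zero_iff ι⟩
  obtain ⟨hfin, hsum⟩ := sum_sectionTerm ι hs
  exact ⟨hfin, by rw [hsum, ncard_projOrbit, hbif_eq]⟩
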